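/- Let $\mathcal S^{\mathrm{poly}}$ be the set of functions $F$ in the Selberg class which for $\operatorname{Re}s>1$ have a polynomial Euler product $F(s)=\prod_p\prod_{j=1}^d(1-\alpha_j(p)p^{-s})^{-1}$ with $|\alpha_j(p)|\le 1$. Let $F\in\mathcal S^{\mathrm{poly}}$, and let $\Phi(s)=\omega\,\overline{\Phi(1-\overline s)}$, $\Phi(s)=\gamma(s)F(s)$, $\gamma(s)=Q^s\prod_{j=1}^r\Gamma(\lambda_js+\mu_j)$, with $r\ge0$, $Q>0$, $\lambda_j>0$, $\operatorname{Re}\mu_j\ge 0$, $|\omega|=1$, be its functional equation. (The case $r=1$, $\lambda_1=1$ is included.) A zero of $F$ is called trivial if it is a pole of $\gamma$, and non-trivial otherwise. Let $Z$ be the set of all non-trivial zeros of $F$ with positive imaginary part together with the trivial zeros of $F$ on the positive imaginary axis, and assume that every $\rho\in Z$ is a simple zero of $F$. Then: 1. for every real $T$, the set of $\rho\in Z$ with $\operatorname{Im}\rho<T$ is finite; 2. there are a real sequence $(T_n)$ and constants $C$, $K$, $n_0$ such that for all $n\ge n_0$ we have $T_n\in[n,n+1]$ and, for all real $\sigma\ge-2$,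 $F(\sigma+iT_n)\ne0$ and $$|F(\sigma+iT_n)|^{-1}\le K\exp\bigl(C(\log n)^2\bigr);$$ 3. for every sequence $(T_n)$ as in 2 and every complex $z$ with $\operatorname{Im}z>0$, the limit $$f(z,F)=\lim_{n\to\infty}\sum_{\rho\in Z,\ 0<\operatorname{Im}\rho<T_n}\frac{e^{\rho z}\,\zeta(\rho-1)}{F'(\rho)}$$ exists in $\mathbb C$. -/

import Mathlib

open Filter Topology Asymptotics
open scoped ComplexConjugate

namespace SelbergClass

/-- The data `(r, Q, λ_j, μ_j, ω)` of a functional equation of Selberg type. -/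
structure FEData where
  r : ℕ
  Q : ℝ
  lam : Fin r → ℝ
  mu : Fin r → ℂ
  omega : ℂ
  Q_pos : 0 < Q
  lam_pos : ∀ j, 0 < lam j
  mu_re_nonneg : ∀ j, 0 ≤ (mu j).re
  norm_omega : ‖omega‖ = 1

/-- The gamma factor `γ(s) = Q ^ s * ∏ j, Γ (λ_j s + μ_j)`. -/
noncomputable def FEData.gammaFactor (g : FEData) (s : ℂ) : ℂ :=
  (g.Q : ℂ) ^ s * ∏ j, Complex.Gamma ((g.lam j : ℂ) * s + g.mu j)

/-- `s` is a pole of the gamma factor: some `λ_j s + μ_j` is a non-positive integer. -/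
def FEData.IsPole (g : FEData) (s : ℂ) : Prop :=
  ∃ (j : Fin g.r) (k : ℕ), (g.lam j : ℂ) * s + g.mu j = -(k : ℂ)

/-- `Φ(s) = ω * conj (Φ (1 - conj s))` with `Φ(s) = γ(s) F(s)`, as an identity of meromorphic
functions: it is required at every `s` at which none of the factors involved has a pole
(`F` can have a pole only at `1`). -/
def FEData.FunctionalEquation (g : FEData) (F : ℂ → ℂ) : Prop :=
  ∀ s : ℂ, s ≠ 0 → s ≠ 1 → ¬ g.IsPole s → ¬ g.IsPole (1 - conj s) →
    g.gammaFactor s * F s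
      = g.omega * conj (g.gammaFactor (1 - conj s) * F (1 - conj s))

/-- An entire function of finite order. -/
def IsEntireOfFiniteOrder (G : ℂ → ℂ) : Prop :=
  Differentiable ℂ G ∧
    ∃ A C : ℝ, 0 < A ∧ ∀ s : ℂ, ‖G s‖ ≤ C * Real.exp (‖s‖ ^ A)

/-- Membership in the Selberg class. The function is given on all of `ℂ`; its value at the
possible pole `1` is irrelevant. -/
structure IsSelberg (F : ℂ → ℂ) : Prop where
  /-- Absolutely convergent Dirichlet series for `Re s > 1`, whose coefficients satisfy the
  Ramanujan bound. -/
  dirichlet_ramanujan : ∃ a : ℕ → ℂ,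
    (∀ s : ℂ, 1 < s.re → LSeriesHasSum a s (F s)) ∧
    ∀ ε : ℝ, 0 < ε → a =O[atTop] fun n : ℕ => (n : ℝ) ^ ε
  /-- `(s - 1) ^ m * F s` is entire of finite order for some `m`. -/
  continuation : ∃ (m : ℕ) (G : ℂ → ℂ), IsEntireOfFiniteOrder G ∧
    ∀ s : ℂ, s ≠ 1 → (s - 1) ^ m * F s = G s
  functional_equation : ∃ g : FEData, g.FunctionalEquation F
  /-- Euler product `F s = ∏ p, exp (∑ ℓ, b (p ^ ℓ) / p ^ (ℓ s))`. -/
  euler_product : ∃ b : ℕ → ℂ,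
    (∀ n : ℕ, ¬ IsPrimePow n → b n = 0) ∧
    (∃ θ : ℝ, θ < 1 / 2 ∧ b =O[atTop] fun n : ℕ => (n : ℝ) ^ θ) ∧
    ∀ s : ℂ, 1 < s.re →
      HasProd (fun p : Nat.Primes =>
        Complex.exp (∑' l : ℕ, b ((p : ℕ) ^ l) / ((p : ℕ) : ℂ) ^ ((l : ℂ) * s))) (F s)

/-- `F` has a polynomial Euler product
`F s = ∏ p, ∏ j ≤ d, (1 - α_j(p) / p ^ s)⁻¹` for `Re s > 1`, with all `|α_j(p)| ≤ 1`. -/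
def HasPolynomialEulerProduct (F : ℂ → ℂ) : Prop :=
  ∃ (d : ℕ) (α : Fin d → Nat.Primes → ℂ),
    (∀ j p, ‖α j p‖ ≤ 1) ∧
    ∀ s : ℂ, 1 < s.re →
      HasProd (fun p : Nat.Primes =>
        ∏ j, (1 - α j p / ((p : ℕ) : ℂ) ^ s)⁻¹) (F s)

/-- The Selberg class with polynomial Euler product. -/
structure IsSelbergPoly (F : ℂ → ℂ) : Prop extends IsSelberg F where
  polynomial_euler_product : HasPolynomialEulerProduct F

/-- Trivial zeros: the zeros of `F` located at the poles of the gamma factor. -/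
def IsTrivialZero (g : FEData) (F : ℂ → ℂ) (ρ : ℂ) : Prop :=
  F ρ = 0 ∧ g.IsPole ρ

/-- Non-trivial zeros: all the other zeros of `F`. -/
def IsNontrivialZero (g : FEData) (F : ℂ → ℂ) (ρ : ℂ) : Prop :=
  F ρ = 0 ∧ ¬ g.IsPole ρ

/-- The zeros over which one sums: the non-trivial zeros in the upper half-plane, together with
the trivial zeros on the positive imaginary axis. -/
def upperZeros (g : FEData) (F : ℂ → ℂ) : Set ℂ :=
  {ρ | 0 < ρ.im ∧ (IsNontrivialZero g F ρ ∨ (IsTrivialZero g F ρ ∧ ρ.re = 0))}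

/-- The zeros in `upperZeros g F` of height less than `T`. -/
def upperZerosBelow (g : FEData) (F : ℂ → ℂ) (T : ℝ) : Set ℂ :=
  {ρ | ρ ∈ upperZeros g F ∧ ρ.im < T}

/-- The grouped partial sum
`∑_{0 < Im ρ < T} e ^ (ρ z) ζ(ρ - 1) / F'(ρ)`. -/
noncomputable def groupedSum (g : FEData) (F : ℂ → ℂ) (z : ℂ) (T : ℝ) : ℂ :=
  ∑ᶠ ρ ∈ upperZerosBelow g F T,
    Complex.exp (ρ * z) * riemannZeta (ρ - 1) / deriv F ρ

/-- The sequences `T_n` used for the grouping: for all large `n`, `T_n` lies in `[n, n + 1]`, and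
`|F(σ + i T_n)|⁻¹ = O(exp (C (log n) ^ 2))` uniformly for `σ ≥ -2` (in particular `F` does not
vanish there). -/
def IsGroupingSequence (F : ℂ → ℂ) (T : ℕ → ℝ) : Prop :=
  ∃ (C K : ℝ) (n₀ : ℕ), ∀ n : ℕ, n₀ ≤ n →
    T n ∈ Set.Icc (n : ℝ) (n + 1) ∧
    ∀ σ : ℝ, -2 ≤ σ →
      F (σ + T n * Complex.I) ≠ 0 ∧
      ‖F (σ + T n * Complex.I)‖⁻¹ ≤ K * Real.exp (C * Real.log n ^ 2)

end SelbergClass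

/-! Consecutive partial sums differ by residues of `e^(sz) ζ(s-1) / F(s)`: the zeros in question are
simple and lie in `0 ≤ Re s ≤ 1`, so `2πi` times the difference is the integral over the boundary of
`[-1, 3] × [T_n, T_{n+1}]`. There `|e^(sz)|` is `O(e^(-n Im z))`, `ζ(s-1)` is polynomially bounded
and `1/F` is at most `exp(O(log² n))`. The differences are therefore summable, and the sums form a
Cauchy sequence.

The bound for `1/F` comes from the Euler product on the right edge, from the functional equation and
a polynomial comparison of gamma factors on the left edge, and from the definition of a grouping
sequence on the horizontal edges.

For the existence of such heights, Phragmén–Lindelöf gives polynomial growth of `F` in strips. A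
Jensen-type argument (`card_zeros_le_and_le_norm`) then shows that a fixed disc at height `n`
contains `O(log n)` zeros, and Borel–Carathéodory bounds `F` below by the product of the distances
to them. By pigeonhole some height in `[n, n+1]` stays at distance of order at least `1/log n` from
every ordinate, which suffices. Finiteness holds because the zeros lie in a compact set and a
nonzero entire function has isolated zeros. -/

/-! ### Comparison of the Gamma function on vertical lines. -/

theorem norm_betaIntegral_le (u v : ℂ) :
    ‖Complex.betaIntegral u v‖ ≤ ∫ x in (0 : ℝ)..1, x ^ (u.re - 1) * (1 - x) ^ (v.re - 1) := by
  unfold Complex.betaIntegral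
  refine (intervalIntegral.norm_integral_le_integral_norm zero_le_one).trans (le_of_eq ?_)
  rw [intervalIntegral.integral_of_le zero_le_one, intervalIntegral.integral_of_le zero_le_one,
    MeasureTheory.integral_Ioc_eq_integral_Ioo, MeasureTheory.integral_Ioc_eq_integral_Ioo]
  refine MeasureTheory.setIntegral_congr_fun measurableSet_Ioo fun x hx => ?_
  have h1 : (1 - (x : ℂ)) = ((1 - x : ℝ) : ℂ) := by push_cast; ring
  simp only [norm_mul]
  rw [h1, Complex.norm_cpow_eq_rpow_re_of_pos hx.1,
    Complex.norm_cpow_eq_rpow_re_of_pos (sub_pos.2 hx.2)]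
  simp

/-- In `Γ(s) Γ(t) = Γ(s+t) B(s,t)` with `t = x₂ - x₁` real, the Beta integral is bounded
independently of `Im s`. This replaces Stirling's formula. -/
theorem exists_norm_Gamma_le_of_lt {x₁ x₂ : ℝ} (h₁ : 0 < x₁) (h₂ : x₁ < x₂) :
    ∃ C : ℝ, 0 ≤ C ∧ ∀ y : ℝ,
      ‖Complex.Gamma (x₁ + y * Complex.I)‖ ≤ C * ‖Complex.Gamma (x₂ + y * Complex.I)‖ := by
  have hpos : 0 < ‖Complex.Gamma ((x₂ - x₁ : ℝ) : ℂ)‖ :=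
    norm_pos_iff.2 (Complex.Gamma_ne_zero_of_re_pos (by simpa using h₂))
  set D : ℝ := ∫ x in (0 : ℝ)..1, x ^ (x₁ - 1) * (1 - x) ^ (x₂ - x₁ - 1)
  have key : ∀ y : ℝ, ‖Complex.Gamma (x₁ + y * Complex.I)‖ * ‖Complex.Gamma ((x₂ - x₁ : ℝ) : ℂ)‖
      ≤ ‖Complex.Gamma (x₂ + y * Complex.I)‖ * D := by
    intro y
    have h := Complex.Gamma_mul_Gamma_eq_betaIntegral (s := x₁ + y * Complex.I)
      (t := ((x₂ - x₁ : ℝ) : ℂ)) (by simpa using h₁) (by simpa using h₂)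
    rw [← norm_mul, h, norm_mul]
    have e : (x₁ + y * Complex.I + ((x₂ - x₁ : ℝ) : ℂ)) = x₂ + y * Complex.I := by
      push_cast; ring
    rw [e]
    gcongr
    refine (norm_betaIntegral_le _ _).trans (le_of_eq ?_)
    simp [D]
  refine ⟨|D| / ‖Complex.Gamma ((x₂ - x₁ : ℝ) : ℂ)‖, by positivity, fun y => ?_⟩
  rw [div_mul_eq_mul_div, le_div_iff₀ hpos]
  refine (key y).trans ?_
  rw [mul_comm]
  gcongr
  exact le_abs_self D

theorem norm_Gamma_add_natCast_le {w : ℂ} (hw : w.im ≠ 0) (M : ℕ) :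
    ‖Complex.Gamma (w + M)‖ ≤ (‖w‖ + M) ^ M * ‖Complex.Gamma w‖ := by
  have : ∀ k ≤ M, ‖Complex.Gamma (w + k)‖ ≤ (‖w‖ + M) ^ k * ‖Complex.Gamma w‖ := by
    intro k
    induction k with
    | zero => simp
    | succ k ih =>
      intro hk
      have hne : w + k ≠ 0 := fun h => hw (by simpa using congrArg Complex.im h)
      have e : w + (k + 1 : ℕ) = w + k + 1 := by push_cast; ring
      rw [e, Complex.Gamma_add_one _ hne, norm_mul, pow_succ']
      have h1 : ‖w + k‖ ≤ ‖w‖ + M := by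
        refine (norm_add_le _ _).trans ?_
        simp only [Complex.norm_natCast]
        gcongr
        omega
      rw [mul_assoc]
      exact mul_le_mul h1 (ih (by omega)) (norm_nonneg _) (by positivity)
  exact this M le_rfl

theorem norm_Gamma_le_norm_Gamma_add_natCast {w : ℂ} (hw : 1 ≤ |w.im|) (M : ℕ) :
    ‖Complex.Gamma w‖ ≤ ‖Complex.Gamma (w + M)‖ := by
  induction M with
  | zero => simp
  | succ k ih =>
    have h1 : 1 ≤ ‖w + k‖ := by
      refine hw.trans ?_
      simpa using Complex.abs_im_le_norm (w + k)
    have hne : w + k ≠ 0 := fun h => by norm_num [h] at h1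
    have e : w + (k + 1 : ℕ) = w + k + 1 := by push_cast; ring
    rw [e, Complex.Gamma_add_one _ hne, norm_mul]
    exact ih.trans (le_mul_of_one_le_left (norm_nonneg _) h1)

/-- On vertical lines the Gamma function has comparable size, up to powers of the height. -/
theorem exists_norm_Gamma_le (x₁ x₂ : ℝ) :
    ∃ (C : ℝ) (N : ℕ), 0 ≤ C ∧ ∀ y : ℝ, 1 ≤ |y| →
      ‖Complex.Gamma (x₁ + y * Complex.I)‖
        ≤ C * (1 + |y|) ^ N * ‖Complex.Gamma (x₂ + y * Complex.I)‖ := by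
  -- `K` makes `x₁ + K` positive and `M` puts `x₂ + M` to its right, where the Beta comparison
  -- applies; the recurrence accounts for both shifts.
  obtain ⟨K, hK⟩ := exists_nat_gt (-x₁)
  obtain ⟨M, hM⟩ := exists_nat_gt (x₁ + K - x₂)
  obtain ⟨C, hC0, hC⟩ := exists_norm_Gamma_le_of_lt (x₁ := x₁ + K) (x₂ := x₂ + M)
    (by linarith) (by linarith)
  refine ⟨C * (|x₂| + M + 1) ^ M, M, by positivity, fun y hy => ?_⟩
  have hyne : y ≠ 0 := fun h => by norm_num [h] at hy
  have h1 := norm_Gamma_le_norm_Gamma_add_natCast (w := x₁ + y * Complex.I) (by simpa using hy) K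
  have h2 := norm_Gamma_add_natCast_le (w := x₂ + y * Complex.I) (by simpa using hyne) M
  have h3 := hC y
  have e1 : ((x₁ + K : ℝ) : ℂ) + y * Complex.I = x₁ + y * Complex.I + K := by push_cast; ring
  have e2 : ((x₂ + M : ℝ) : ℂ) + y * Complex.I = x₂ + y * Complex.I + M := by push_cast; ring
  rw [e1, e2] at h3
  have h4 : ‖(x₂ + y * Complex.I : ℂ)‖ + M ≤ (|x₂| + M + 1) * (1 + |y|) := by
    have : ‖(x₂ + y * Complex.I : ℂ)‖ ≤ |x₂| + |y| := by
      refine (norm_add_le _ _).trans ?_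
      simp
    have h5 : 0 ≤ (|x₂| + M) * |y| := by positivity
    linarith
  calc _ ≤ C * ‖Complex.Gamma (x₂ + y * Complex.I + M)‖ := h1.trans h3
    _ ≤ C * ((‖(x₂ + y * Complex.I : ℂ)‖ + M) ^ M * ‖Complex.Gamma (x₂ + y * Complex.I)‖) := by
      gcongr
    _ ≤ C * (((|x₂| + M + 1) * (1 + |y|)) ^ M * ‖Complex.Gamma (x₂ + y * Complex.I)‖) := by
      gcongr
    _ = _ := by rw [mul_pow]; ring

/-! ### The gamma factor and reflection in the critical line. -/

namespace SelbergClass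

namespace FEData

variable (g : FEData)

theorem not_isPole_of_re_pos {s : ℂ} (hs : 0 < s.re) : ¬ g.IsPole s := by
  rintro ⟨j, k, h⟩
  have h1 := congrArg Complex.re h
  simp only [Complex.add_re, Complex.mul_re, Complex.ofReal_re, Complex.ofReal_im, zero_mul,
    sub_zero, Complex.neg_re, Complex.natCast_re] at h1
  have := mul_pos (g.lam_pos j) hs
  have := g.mu_re_nonneg j
  have : (0 : ℝ) ≤ k := k.cast_nonneg
  linarith

theorem gammaFactor_ne_zero {s : ℂ} (hs : ¬ g.IsPole s) : g.gammaFactor s ≠ 0 := by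
  refine mul_ne_zero ?_ (Finset.prod_ne_zero_iff.2 fun j _ => Complex.Gamma_ne_zero fun k hk => ?_)
  · rw [Complex.cpow_def_of_ne_zero (by exact_mod_cast g.Q_pos.ne')]
    exact Complex.exp_ne_zero _
  · exact hs ⟨j, k, hk⟩

theorem exists_one_le_abs_im :
    ∃ t₀ : ℝ, 1 ≤ t₀ ∧ ∀ t : ℝ, t₀ ≤ |t| → ∀ j, 1 ≤ |g.lam j * t + (g.mu j).im| := by
  have hnn : ∀ j, 0 ≤ (1 + |(g.mu j).im|) / g.lam j := fun j =>
    div_nonneg (by positivity) (g.lam_pos j).le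
  -- A sum over `j` instead of a maximum, so that `r = 0` is not a special case.
  refine ⟨1 + ∑ j, (1 + |(g.mu j).im|) / g.lam j,
    le_add_of_nonneg_right (Finset.sum_nonneg fun j _ => hnn j), fun t ht j => ?_⟩
  have h1 := Finset.single_le_sum (fun i _ => hnn i) (Finset.mem_univ j)
  have h2 : (1 + |(g.mu j).im|) / g.lam j ≤ |t| := by linarith
  rw [div_le_iff₀ (g.lam_pos j)] at h2
  have h3 : |g.lam j * t| = |t| * g.lam j := by rw [abs_mul, abs_of_pos (g.lam_pos j), mul_comm]
  have h4 := abs_sub_abs_le_abs_sub (g.lam j * t) (-(g.mu j).im)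
  rw [abs_neg, sub_neg_eq_add] at h4
  linarith

theorem exists_not_isPole_of_le_abs_im :
    ∃ t₀ : ℝ, 1 ≤ t₀ ∧ ∀ s : ℂ, t₀ ≤ |s.im| → ¬ g.IsPole s := by
  obtain ⟨t₀, h0, h⟩ := g.exists_one_le_abs_im
  refine ⟨t₀, h0, ?_⟩
  rintro s hs ⟨j, k, hjk⟩
  have h1 := congrArg Complex.im hjk
  simp at h1
  have h2 := h _ hs j
  rw [h1] at h2
  norm_num at h2

theorem norm_gammaFactor (x t : ℝ) :
    ‖g.gammaFactor (x + t * Complex.I)‖ = g.Q ^ x *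
      ∏ j, ‖Complex.Gamma ((g.lam j * x + (g.mu j).re : ℝ)
        + (g.lam j * t + (g.mu j).im : ℝ) * Complex.I)‖ := by
  unfold gammaFactor
  rw [norm_mul, Complex.norm_cpow_eq_rpow_re_of_pos g.Q_pos, norm_prod]
  congr 1
  · simp
  · refine Finset.prod_congr rfl fun j _ => ?_
    congr 2
    conv_lhs => rw [← Complex.re_add_im (g.mu j)]
    push_cast
    ring

theorem exists_norm_gammaFactor_le (x₁ x₂ : ℝ) :
    ∃ (C : ℝ) (N : ℕ) (t₀ : ℝ), 0 ≤ C ∧ 1 ≤ t₀ ∧ ∀ t : ℝ, t₀ ≤ |t| →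
      ‖g.gammaFactor (x₁ + t * Complex.I)‖
        ≤ C * (1 + |t|) ^ N * ‖g.gammaFactor (x₂ + t * Complex.I)‖ := by
  obtain ⟨t₀, ht₀, him⟩ := g.exists_one_le_abs_im
  choose C N hC h using fun j => exists_norm_Gamma_le (g.lam j * x₁ + (g.mu j).re)
    (g.lam j * x₂ + (g.mu j).re)
  have hQ := g.Q_pos
  refine ⟨g.Q ^ (x₁ - x₂) * ∏ j, (C j * (1 + g.lam j + |(g.mu j).im|) ^ N j), ∑ j, N j, t₀,
    ?_, ht₀, fun t ht => ?_⟩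
  · refine mul_nonneg (by positivity) (Finset.prod_nonneg fun j _ => ?_)
    have := hC j; have := g.lam_pos j
    positivity
  rw [norm_gammaFactor, norm_gammaFactor, ← Finset.prod_pow_eq_pow_sum, Real.rpow_sub hQ]
  have hle : ∏ j, ‖Complex.Gamma ((g.lam j * x₁ + (g.mu j).re : ℝ)
        + (g.lam j * t + (g.mu j).im : ℝ) * Complex.I)‖ ≤
      ∏ j, ((C j * (1 + g.lam j + |(g.mu j).im|) ^ N j) * (1 + |t|) ^ N j *
        ‖Complex.Gamma ((g.lam j * x₂ + (g.mu j).re : ℝ)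
        + (g.lam j * t + (g.mu j).im : ℝ) * Complex.I)‖) := by
    refine Finset.prod_le_prod (fun j _ => norm_nonneg _) fun j _ => ?_
    refine (h j _ (him t ht j)).trans ?_
    have hl := g.lam_pos j
    have h1 : 1 + |g.lam j * t + (g.mu j).im| ≤ (1 + g.lam j + |(g.mu j).im|) * (1 + |t|) := by
      have h2 := abs_add_le (g.lam j * t) (g.mu j).im
      rw [abs_mul, abs_of_pos hl] at h2
      have h3 : 0 ≤ |(g.mu j).im| * |t| := by positivity
      have h4 := abs_nonneg t
      linarith
    rw [mul_assoc (C j) (_ ^ _) (_ ^ _), ← mul_pow]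
    have := hC j
    gcongr
  rw [Finset.prod_mul_distrib, Finset.prod_mul_distrib] at hle
  calc _ ≤ g.Q ^ x₁ * _ := mul_le_mul_of_nonneg_left hle (by positivity)
    _ = _ := by
      have h2 := inv_mul_cancel₀ (Real.rpow_pos_of_pos hQ x₂).ne'
      rw [div_eq_mul_inv]
      nth_rw 1 [← mul_one (g.Q ^ x₁), ← h2]
      ring

variable {g}

theorem FunctionalEquation.norm_eq {F : ℂ → ℂ} (hg : g.FunctionalEquation F) {s : ℂ}
    (h0 : s ≠ 0) (h1 : s ≠ 1) (hp : ¬ g.IsPole s) (hp' : ¬ g.IsPole (1 - conj s)) :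
    ‖g.gammaFactor s‖ * ‖F s‖ = ‖g.gammaFactor (1 - conj s)‖ * ‖F (1 - conj s)‖ := by
  rw [← norm_mul, hg s h0 h1 hp hp', norm_mul, g.norm_omega, one_mul, RCLike.norm_conj, norm_mul]

theorem FunctionalEquation.ne_zero_of_reflect {F : ℂ → ℂ} (hg : g.FunctionalEquation F) {s : ℂ}
    (h0 : s ≠ 0) (h1 : s ≠ 1) (hp : ¬ g.IsPole s) (hp' : ¬ g.IsPole (1 - conj s))
    (hF : F (1 - conj s) ≠ 0) : F s ≠ 0 := by
  intro h
  have h2 := hg.norm_eq h0 h1 hp hp'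
  rw [h, norm_zero, mul_zero, eq_comm, mul_eq_zero, norm_eq_zero, norm_eq_zero] at h2
  exact h2.elim (g.gammaFactor_ne_zero hp') hF

/-- The functional equation compares `F` on two lines that are symmetric about the critical line. -/
theorem FunctionalEquation.exists_norm_le {F : ℂ → ℂ} (hg : g.FunctionalEquation F) (x : ℝ) :
    ∃ (C : ℝ) (N : ℕ) (t₀ : ℝ), 0 ≤ C ∧ 1 ≤ t₀ ∧ ∀ t : ℝ, t₀ ≤ |t| →
      ‖F (x + t * Complex.I)‖ ≤ C * (1 + |t|) ^ N * ‖F ((1 - x : ℝ) + t * Complex.I)‖ := by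
  obtain ⟨C, N, t₀, hC, ht₀, h⟩ := g.exists_norm_gammaFactor_le (1 - x) x
  obtain ⟨t₁, ht₁, hpole⟩ := g.exists_not_isPole_of_le_abs_im
  refine ⟨C, N, max t₀ t₁, hC, ht₀.trans (le_max_left _ _), fun t ht => ?_⟩
  set s : ℂ := x + t * Complex.I with hs
  have him : s.im = t := by simp [hs]
  have htp : 0 < |t| := by linarith [(le_max_left _ _).trans ht]
  have hne : t ≠ 0 := abs_pos.1 htp
  -- The reflection preserves the height `t`, so the two gamma factors are compared at the same
  -- height.
  have e : 1 - conj s = ((1 - x : ℝ) : ℂ) + t * Complex.I := by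
    simp [hs]; ring
  have hp := hpole s (by rw [him]; exact (le_max_right _ _).trans ht)
  have h2 := hg.norm_eq (s := s) (fun h => hne (by rw [← him, h]; simp))
    (fun h => hne (by rw [← him, h]; simp)) hp
    (hpole _ (by rw [e]; simpa using (le_max_right _ _).trans ht))
  rw [e] at h2
  have hpos : 0 < ‖g.gammaFactor s‖ := norm_pos_iff.2 (g.gammaFactor_ne_zero hp)
  refine le_of_mul_le_mul_left ?_ hpos
  rw [h2]
  calc _ ≤ C * (1 + |t|) ^ N * ‖g.gammaFactor s‖ * ‖F ((1 - x : ℝ) + t * Complex.I)‖ := by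
        gcongr; exact h t ((le_max_left _ _).trans ht)
    _ = _ := by ring

end FEData

end SelbergClass

/-! ### Bounds for `F` to the right of the critical strip. -/

theorem exp_neg_le_norm_inv_one_sub {x : ℂ} (hx : ‖x‖ < 1) :
    Real.exp (-‖x‖) ≤ ‖(1 - x)⁻¹‖ := by
  have hne : 0 < ‖1 - x‖ := by
    refine norm_pos_iff.2 fun h => ?_
    rw [← sub_eq_zero.1 h] at hx
    norm_num at hx
  rw [Real.exp_neg, norm_inv]
  refine inv_anti₀ hne ?_
  have h1 := norm_sub_le (1 : ℂ) x
  rw [norm_one] at h1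
  linarith [Real.add_one_le_exp ‖x‖]

namespace SelbergClass

/-- Each local factor is at least `exp(-p^(-σ))`, so all finite partial products share one positive
lower bound, which survives the limit. `HasProd` alone would not exclude the value `0`. -/
theorem HasPolynomialEulerProduct.exists_exp_neg_le_norm {F : ℂ → ℂ}
    (hF : HasPolynomialEulerProduct F) :
    ∃ d : ℕ, ∀ s : ℂ, 1 < s.re →
      Real.exp (-(d * ∑' p : Nat.Primes, ((p : ℕ) : ℝ) ^ (-s.re))) ≤ ‖F s‖ := by
  obtain ⟨d, α, hα, h⟩ := hF
  refine ⟨d, fun s hs => ?_⟩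
  have hsum : Summable fun p : Nat.Primes => ((p : ℕ) : ℝ) ^ (-s.re) :=
    Nat.Primes.summable_rpow.2 (by linarith)
  refine ge_of_tendsto ((h s hs).norm) (Eventually.of_forall fun A => ?_)
  have hle : ∑ p ∈ A, ((p : ℕ) : ℝ) ^ (-s.re) ≤ ∑' p : Nat.Primes, ((p : ℕ) : ℝ) ^ (-s.re) :=
    hsum.sum_le_tsum A fun p _ => by positivity
  have hfac : ∀ (p : Nat.Primes) (j : Fin d),
      Real.exp (-((p : ℕ) : ℝ) ^ (-s.re)) ≤ ‖(1 - α j p / ((p : ℕ) : ℂ) ^ s)⁻¹‖ := by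
    intro p j
    have hp : 1 < ((p : ℕ) : ℝ) := by exact_mod_cast p.2.one_lt
    have hx : ‖α j p / ((p : ℕ) : ℂ) ^ s‖ ≤ ((p : ℕ) : ℝ) ^ (-s.re) := by
      rw [norm_div, Complex.norm_natCast_cpow_of_pos p.2.pos, Real.rpow_neg (by positivity),
        div_eq_mul_inv]
      exact mul_le_of_le_one_left (by positivity) (hα j p)
    have hx1 : ((p : ℕ) : ℝ) ^ (-s.re) < 1 := Real.rpow_lt_one_of_one_lt_of_neg hp (by linarith)
    refine le_trans ?_ (exp_neg_le_norm_inv_one_sub (hx.trans_lt hx1))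
    exact Real.exp_le_exp.2 (neg_le_neg hx)
  calc Real.exp (-(d * ∑' p : Nat.Primes, ((p : ℕ) : ℝ) ^ (-s.re)))
      ≤ Real.exp (∑ p ∈ A, ∑ _j : Fin d, (-((p : ℕ) : ℝ) ^ (-s.re))) := by
        refine Real.exp_le_exp.2 ?_
        simp only [Finset.sum_neg_distrib, Finset.sum_const, Finset.card_univ, Fintype.card_fin,
          nsmul_eq_mul, ← Finset.mul_sum]
        gcongr
    _ = ∏ p ∈ A, ∏ _j : Fin d, Real.exp (-((p : ℕ) : ℝ) ^ (-s.re)) := by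
        simp only [Real.exp_sum]
    _ ≤ ∏ p ∈ A, ∏ j, ‖(1 - α j p / ((p : ℕ) : ℂ) ^ s)⁻¹‖ := by
        gcongr with p _ j _
        exact hfac p j
    _ = _ := by simp only [norm_prod]

theorem HasPolynomialEulerProduct.ne_zero {F : ℂ → ℂ} (hF : HasPolynomialEulerProduct F) {s : ℂ}
    (hs : 1 < s.re) : F s ≠ 0 := by
  obtain ⟨d, h⟩ := hF.exists_exp_neg_le_norm
  exact norm_pos_iff.1 ((Real.exp_pos _).trans_le (h s hs))

theorem HasPolynomialEulerProduct.exists_le_norm {F : ℂ → ℂ} (hF : HasPolynomialEulerProduct F) :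
    ∃ c : ℝ, 0 < c ∧ ∀ s : ℂ, 2 ≤ s.re → c ≤ ‖F s‖ := by
  obtain ⟨d, h⟩ := hF.exists_exp_neg_le_norm
  refine ⟨_, Real.exp_pos (-(d * ∑' p : Nat.Primes, ((p : ℕ) : ℝ) ^ (-2 : ℝ))), fun s hs => ?_⟩
  refine le_trans (Real.exp_le_exp.2 (neg_le_neg ?_)) (h s (by linarith))
  refine mul_le_mul_of_nonneg_left ?_ d.cast_nonneg
  refine Summable.tsum_le_tsum (fun p => ?_) (Nat.Primes.summable_rpow.2 (by linarith))
    (Nat.Primes.summable_rpow.2 (by norm_num))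
  exact Real.rpow_le_rpow_of_exponent_le (by exact_mod_cast p.2.one_lt.le) (by linarith)

theorem exists_norm_le_of_LSeriesHasSum {F : ℂ → ℂ} {a : ℕ → ℂ}
    (h : ∀ s : ℂ, 1 < s.re → LSeriesHasSum a s (F s)) :
    ∃ C : ℝ, 0 ≤ C ∧ ∀ s : ℂ, 2 ≤ s.re → ‖F s‖ ≤ C := by
  have h2 : Summable fun n => ‖LSeries.term a 2 n‖ := (h 2 (by norm_num)).summable.norm
  refine ⟨∑' n, ‖LSeries.term a 2 n‖, tsum_nonneg fun n => norm_nonneg _, fun s hs => ?_⟩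
  have hle : ∀ n, ‖LSeries.term a s n‖ ≤ ‖LSeries.term a 2 n‖ := fun n =>
    LSeries.norm_term_le_of_re_le_re a (by simpa using hs) n
  rw [← (h s (by linarith)).tsum_eq]
  exact tsum_of_norm_bounded h2.hasSum hle

theorem IsSelberg.exists_norm_le {F : ℂ → ℂ} (hF : IsSelberg F) :
    ∃ C : ℝ, 0 ≤ C ∧ ∀ s : ℂ, 2 ≤ s.re → ‖F s‖ ≤ C := by
  obtain ⟨a, ha, -⟩ := hF.dirichlet_ramanujan
  exact exists_norm_le_of_LSeriesHasSum ha

end SelbergClass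

/-! ### Polynomial growth in vertical strips. -/

/-- Phragmén–Lindelöf in a vertical strip with polynomial bounds on the two boundary lines. -/
theorem exists_norm_le_of_polynomial_on_lines {G : ℂ → ℂ} (hG : Differentiable ℂ G) {B : ℝ}
    (hB : 0 < B) {A K a t₀ : ℝ} (hA : 0 ≤ A) (ha : 0 ≤ a)
    (hord : ∀ s : ℂ, |s.re| ≤ B → t₀ ≤ |s.im| → ‖G s‖ ≤ K * Real.exp (a * ‖s‖ ^ A))
    {C : ℝ} {N : ℕ} (hline : ∀ s : ℂ, |s.re| = B → t₀ ≤ |s.im| → ‖G s‖ ≤ C * (1 + |s.im|) ^ N) :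
    ∃ C' : ℝ, 0 ≤ C' ∧ ∀ s : ℂ, |s.re| ≤ B → ‖G s‖ ≤ C' * (1 + |s.im|) ^ N := by
  obtain ⟨D, hD⟩ : ∃ D : ℝ, ∀ s ∈ Set.Icc (-B) B ×ℂ Set.Icc (-t₀) t₀, ‖G s‖ ≤ D :=
    (isCompact_Icc.reProdIm isCompact_Icc).exists_bound_of_continuousOn hG.continuous.continuousOn
  -- `|w|` is at least `1` and comparable to `1 + |Im s|` on the strip, so dividing by `w ^ N` turns
  -- the polynomial bounds into constants.
  set w : ℂ → ℂ := fun s => s + (B + 1 : ℝ) with hw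
  have hwre : ∀ s : ℂ, -B ≤ s.re → 1 ≤ (w s).re := fun s hs => by simp [hw]; linarith
  have hwn1 : ∀ s : ℂ, -B ≤ s.re → 1 ≤ ‖w s‖ := fun s hs =>
    (hwre s hs).trans (Complex.re_le_norm _)
  have hwim : ∀ s : ℂ, -B ≤ s.re → 1 + |s.im| ≤ 2 * ‖w s‖ := fun s hs => by
    have := Complex.abs_im_le_norm (w s)
    simp only [hw, Complex.add_im, Complex.ofReal_im, add_zero] at this
    linarith [hwn1 s hs]
  have hwle : ∀ s : ℂ, |s.re| ≤ B → ‖w s‖ ≤ (2 * B + 1) * (1 + |s.im|) := fun s hs => by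
    have h1 := Complex.norm_le_abs_re_add_abs_im s
    have h2 : ‖w s‖ ≤ ‖s‖ + (B + 1) := by
      refine (norm_add_le _ _).trans (le_of_eq ?_)
      rw [Complex.norm_real, Real.norm_of_nonneg (by linarith)]
    have := mul_nonneg hB.le (abs_nonneg s.im)
    linarith
  set H : ℂ → ℂ := fun s => G s / w s ^ N with hH
  have hHd : ∀ s : ℂ, -B ≤ s.re → DifferentiableAt ℂ H s := fun s hs => by
    refine (hG s).div (by fun_prop) (pow_ne_zero _ (norm_pos_iff.1 ?_))
    linarith [hwn1 s hs]
  have hclos : closure (Complex.re ⁻¹' Set.Ioo (-B) B) ⊆ {s | -B ≤ s.re} :=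
    closure_minimal (fun s hs => hs.1.le) (isClosed_le continuous_const Complex.continuous_re)
  have hline' : ∀ s : ℂ, |s.re| = B → ‖H s‖ ≤ |D| + |C| * 2 ^ N := by
    intro s hs
    have hre : -B ≤ s.re := (abs_le.1 hs.le).1
    have hpos : 0 < ‖w s‖ ^ N := pow_pos (by linarith [hwn1 s hre]) N
    simp only [hH, norm_div, norm_pow]
    rw [div_le_iff₀ hpos]
    rcases le_total t₀ |s.im| with ht | ht
    · calc ‖G s‖ ≤ C * (1 + |s.im|) ^ N := hline s hs ht
        _ ≤ |C| * (2 * ‖w s‖) ^ N := by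
          gcongr
          · exact le_abs_self C
          · exact hwim s hre
        _ = |C| * 2 ^ N * ‖w s‖ ^ N := by rw [mul_pow]; ring
        _ ≤ _ := by gcongr; exact le_add_of_nonneg_left (abs_nonneg D)
    · calc ‖G s‖ ≤ D := hD s ⟨abs_le.1 hs.le, abs_le.1 ht⟩
        _ ≤ |D| * 1 := by rw [mul_one]; exact le_abs_self D
        _ ≤ (|D| + |C| * 2 ^ N) * ‖w s‖ ^ N := by
          gcongr
          · exact le_add_of_nonneg_right (by positivity)
          · exact one_le_pow₀ (hwn1 s hre)
  -- Phragmén–Lindelöf in a strip of width `2B` admits `exp(exp(c |Im s|))` for `c < π / (2B)`; `c =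
  -- 1/B` qualifies because `π > 2`, and finite order stays far below this.
  have hgrow : H =O[comap (_root_.abs ∘ Complex.im) atTop ⊓ 𝓟 (Complex.re ⁻¹' Set.Ioo (-B) B)]
      fun z ↦ Real.exp (1 * Real.exp (1 / B * |z.im|)) := by
    have hev : ∀ᶠ x : ℝ in atTop, t₀ ≤ x ∧ 0 ≤ x ∧ a * (B + x) ^ A ≤ Real.exp (1 / B * x) := by
      have h1 : (fun x : ℝ => a * (B + x) ^ A) =o[atTop] fun x => Real.exp (1 / B * x) := by
        have h2 : (fun x : ℝ => (B + x) ^ A) =o[atTop] fun x => Real.exp (1 / B * (B + x)) :=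
          (isLittleO_rpow_exp_pos_mul_atTop A (by positivity)).comp_tendsto
            (tendsto_atTop_add_const_left _ B tendsto_id)
        have h3 : (fun x : ℝ => Real.exp (1 / B * (B + x)))
            =O[atTop] fun x => Real.exp (1 / B * x) := by
          refine IsBigO.of_bound (Real.exp 1) (Eventually.of_forall fun x => ?_)
          rw [Real.norm_of_nonneg (Real.exp_pos _).le, Real.norm_of_nonneg (Real.exp_pos _).le,
            ← Real.exp_add]
          refine Real.exp_le_exp.2 (le_of_eq ?_)
          field_simp
        exact (h2.trans_isBigO h3).const_mul_left a
      filter_upwards [eventually_ge_atTop t₀, eventually_ge_atTop 0, h1.bound one_pos]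
        with x hx1 hx2 hx3
      refine ⟨hx1, hx2, ?_⟩
      rw [one_mul, Real.norm_of_nonneg (Real.exp_pos _).le] at hx3
      exact (le_abs_self _).trans hx3
    refine IsBigO.of_bound |K| ?_
    rw [eventually_inf_principal]
    have hev' : ∀ᶠ z : ℂ in comap (_root_.abs ∘ Complex.im) atTop,
      t₀ ≤ |z.im| ∧ 0 ≤ |z.im| ∧ a * (B + |z.im|) ^ A ≤ Real.exp (1 / B * |z.im|) :=
      tendsto_comap.eventually hev
    filter_upwards [hev'] with s ⟨h1, h2, h3⟩ hs
    have hre : -B ≤ s.re := hs.1.le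
    have habs : |s.re| ≤ B := abs_le.2 ⟨hs.1.le, hs.2.le⟩
    rw [Real.norm_of_nonneg (Real.exp_pos _).le, one_mul]
    simp only [hH, norm_div, norm_pow]
    refine (div_le_self (norm_nonneg _) (one_le_pow₀ (hwn1 s hre))).trans ?_
    refine (hord s habs h1).trans ?_
    gcongr
    · exact le_abs_self K
    · refine le_trans ?_ h3
      have := Complex.norm_le_abs_re_add_abs_im s
      gcongr
      linarith
  have hPL : ∀ s : ℂ, |s.re| ≤ B → ‖H s‖ ≤ |D| + |C| * 2 ^ N := fun s hs =>
    PhragmenLindelof.vertical_strip (a := -B) (b := B)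
      ⟨fun s hs => (hHd s hs.1.le).differentiableWithinAt,
        fun s hs => (hHd s (hclos hs)).continuousAt.continuousWithinAt⟩
      ⟨1 / B, by rw [div_lt_div_iff₀ hB (by linarith)]; nlinarith [Real.pi_gt_three], 1, hgrow⟩
      (fun z hz => hline' z (by rw [hz, abs_neg, abs_of_pos hB]))
      (fun z hz => hline' z (by rw [hz, abs_of_pos hB])) (abs_le.1 hs).1 (abs_le.1 hs).2
  refine ⟨(|D| + |C| * 2 ^ N) * (2 * B + 1) ^ N, by positivity, fun s hs => ?_⟩
  have hre : -B ≤ s.re := (abs_le.1 hs).1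
  have hpos : 0 < ‖w s‖ ^ N := pow_pos (by linarith [hwn1 s hre]) N
  have h1 := hPL s hs
  simp only [hH, norm_div, norm_pow] at h1
  rw [div_le_iff₀ hpos] at h1
  rw [mul_assoc, ← mul_pow]
  refine h1.trans ?_
  gcongr
  exact hwle s hs

namespace SelbergClass

/-- A function with a functional equation of Selberg type that is bounded on `Re s ≥ 2` and of
finite order grows at most polynomially in vertical strips. -/
theorem FEData.FunctionalEquation.exists_norm_le_in_strip {g : FEData} {F G : ℂ → ℂ}
    (hg : g.FunctionalEquation F) {m : ℕ} (hG : Differentiable ℂ G)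
    (hFG : ∀ s : ℂ, s ≠ 1 → (s - 1) ^ m * F s = G s)
    {M : ℝ} (hM : ∀ s : ℂ, 2 ≤ s.re → ‖F s‖ ≤ M) {B : ℝ} (hB : 2 ≤ B)
    {A K a t₁ : ℝ} (hA : 0 ≤ A) (ha : 0 ≤ a)
    (hord : ∀ s : ℂ, |s.re| ≤ B → t₁ ≤ |s.im| → ‖G s‖ ≤ K * Real.exp (a * ‖s‖ ^ A)) :
    ∃ (C : ℝ) (N : ℕ), 0 ≤ C ∧
      ∀ s : ℂ, |s.re| ≤ B → 1 ≤ |s.im| → ‖F s‖ ≤ C * (1 + |s.im|) ^ N := by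
  -- The edge `Re s = -B` reflects to `Re s = 1 + B`, where `F` is bounded.
  obtain ⟨C₁, N, t₂, hC₁, ht₂, hrefl⟩ := hg.exists_norm_le (-B)
  set t₀ := max t₁ t₂
  have hM0 : 0 ≤ M := (norm_nonneg _).trans (hM 2 (by norm_num))
  have hFline : ∀ s : ℂ, |s.re| = B → t₀ ≤ |s.im| →
      ‖F s‖ ≤ (M + C₁ * M) * (1 + |s.im|) ^ N := by
    intro s hs ht
    have h1 : 1 ≤ (1 + |s.im|) ^ N := one_le_pow₀ (by linarith [abs_nonneg s.im])
    rcases (abs_eq (by linarith)).1 hs with h | h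
    · calc ‖F s‖ ≤ M * 1 := by rw [mul_one]; exact hM s (by linarith)
        _ ≤ (M + C₁ * M) * (1 + |s.im|) ^ N := by
          gcongr
          exact le_add_of_nonneg_right (by positivity)
    · have h2 := hrefl s.im ((le_max_right _ _).trans ht)
      have e : ((-B : ℝ) : ℂ) + s.im * Complex.I = s := by rw [← h]; exact Complex.re_add_im s
      rw [e] at h2
      refine h2.trans ?_
      have h3 : ‖F ((1 - -B : ℝ) + s.im * Complex.I)‖ ≤ M := hM _ (by simp; linarith)
      calc _ ≤ C₁ * (1 + |s.im|) ^ N * M := by gcongr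
        _ = C₁ * M * (1 + |s.im|) ^ N := by ring
        _ ≤ _ := by gcongr; exact le_add_of_nonneg_left hM0
  have hs1 : ∀ s : ℂ, |s.re| ≤ B → ‖s - 1‖ ≤ (B + 1) * (1 + |s.im|) := fun s hs => by
    have h1 := norm_sub_le s 1
    rw [norm_one] at h1
    have h2 := Complex.norm_le_abs_re_add_abs_im s
    have := mul_nonneg (by linarith : (0 : ℝ) ≤ B) (abs_nonneg s.im)
    linarith
  have hne : ∀ s : ℂ, 1 ≤ |s.im| → s ≠ 1 := fun s hs h => by norm_num [h] at hs
  have hGline : ∀ s : ℂ, |s.re| = B → t₀ ≤ |s.im| →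
      ‖G s‖ ≤ ((B + 1) ^ m * (M + C₁ * M)) * (1 + |s.im|) ^ (m + N) := by
    intro s hs ht
    rw [← hFG s (hne s (ht₂.trans ((le_max_right _ _).trans ht))), norm_mul, norm_pow]
    calc _ ≤ ((B + 1) * (1 + |s.im|)) ^ m * ((M + C₁ * M) * (1 + |s.im|) ^ N) := by
          gcongr
          · exact hs1 s hs.le
          · exact hFline s hs ht
      _ = _ := by rw [mul_pow]; ring
  obtain ⟨C', hC', h⟩ := exists_norm_le_of_polynomial_on_lines hG (by linarith) hA ha
    (fun s hs ht => hord s hs ((le_max_left _ _).trans ht)) hGline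
  refine ⟨C', m + N, hC', fun s hs ht => le_trans ?_ (h s hs)⟩
  rw [← hFG s (hne s ht), norm_mul, norm_pow]
  -- `|s - 1| ≥ 1` at these heights, so returning from `G` to `F` costs nothing.
  refine le_mul_of_one_le_left (norm_nonneg _) (one_le_pow₀ (ht.trans ?_))
  simpa using Complex.abs_im_le_norm (s - 1)

theorem IsSelberg.exists_norm_le_in_strip {F : ℂ → ℂ} (hF : IsSelberg F) {B : ℝ} (hB : 2 ≤ B) :
    ∃ (C : ℝ) (N : ℕ), 0 ≤ C ∧
      ∀ s : ℂ, |s.re| ≤ B → 1 ≤ |s.im| → ‖F s‖ ≤ C * (1 + |s.im|) ^ N := by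
  obtain ⟨m, G, ⟨hG, A, K, hA, hord⟩, hFG⟩ := hF.continuation
  obtain ⟨g, hg⟩ := hF.functional_equation
  obtain ⟨M, -, hM⟩ := hF.exists_norm_le
  exact hg.exists_norm_le_in_strip hG hFG hM hB hA.le zero_le_one (t₁ := 0)
    fun s _ _ => by simpa using hord s

end SelbergClass

/-! ### Polynomial growth of the Riemann zeta function. -/

/-- `t^(σ-1) ≤ t^(a-1) + t^(b-1)` for `a ≤ σ ≤ b` and `t > 0`, which makes the bound uniform in `Im
s`. -/
theorem norm_mellin_le {f : ℝ → ℂ} {a b : ℝ} (hf : ∀ s : ℂ, MellinConvergent f s) {s : ℂ}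
    (ha : a ≤ s.re) (hb : s.re ≤ b) :
    ‖mellin f s‖ ≤ ∫ t in Set.Ioi (0 : ℝ), (t ^ (a - 1) * ‖f t‖ + t ^ (b - 1) * ‖f t‖) := by
  have hi : ∀ x : ℝ, MeasureTheory.IntegrableOn (fun t : ℝ => t ^ (x - 1) * ‖f t‖)
      (Set.Ioi 0) := by
    intro x
    have h : MeasureTheory.IntegrableOn (fun t : ℝ => ‖(t : ℂ) ^ ((x : ℂ) - 1) • f t‖)
      (Set.Ioi 0) := (hf x).norm
    refine h.congr_fun (fun t ht => ?_) measurableSet_Ioi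
    simp only [norm_smul]
    rw [Complex.norm_cpow_eq_rpow_re_of_pos ht]
    simp
  refine MeasureTheory.norm_integral_le_of_norm_le ((hi a).add (hi b))
    ((MeasureTheory.ae_restrict_iff' measurableSet_Ioi).2 (Eventually.of_forall fun t ht => ?_))
  have ht0 : (0 : ℝ) < t := ht
  rw [norm_smul, Complex.norm_cpow_eq_rpow_re_of_pos ht0, ← add_mul]
  gcongr
  simp only [Complex.sub_re, Complex.one_re]
  rcases le_total 1 t with h1 | h1
  · exact (Real.rpow_le_rpow_of_exponent_le h1 (by linarith)).trans
      (le_add_of_nonneg_left (by positivity))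
  · exact (Real.rpow_le_rpow_of_exponent_ge ht0 h1 (by linarith)).trans
      (le_add_of_nonneg_right (by positivity))

theorem exists_norm_completedRiemannZeta₀_le (B : ℝ) :
    ∃ C : ℝ, ∀ s : ℂ, |s.re| ≤ B → ‖completedRiemannZeta₀ s‖ ≤ C := by
  set P := HurwitzZeta.hurwitzEvenFEPair 0
  have hf : ∀ s : ℂ, MellinConvergent P.f_modif s := fun s =>
    (P.isStrongFEPair_toStrongFEPair.hasMellin s).1
  refine ⟨(∫ t in Set.Ioi (0 : ℝ), (t ^ (-(B / 2) - 1) * ‖P.f_modif t‖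
    + t ^ (B / 2 - 1) * ‖P.f_modif t‖)) / 2, fun s hs => ?_⟩
  have h1 : completedRiemannZeta₀ s = mellin P.f_modif (s / 2) / 2 := rfl
  rw [h1, norm_div]
  have hre : (s / 2).re = s.re / 2 := by simp
  have := abs_le.1 hs
  have h2 := norm_mellin_le hf (s := s / 2) (a := -(B / 2)) (b := B / 2)
    (by rw [hre]; linarith) (by rw [hre]; linarith)
  rw [Complex.norm_ofNat]
  gcongr

theorem norm_sin_le_exp (z : ℂ) : ‖Complex.sin z‖ ≤ Real.exp ‖z‖ := by
  unfold Complex.sin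
  have h1 : ‖Complex.exp (-z * Complex.I)‖ ≤ Real.exp ‖z‖ := by
    refine (Complex.norm_exp_le_exp_norm _).trans (le_of_eq ?_)
    simp
  have h2 : ‖Complex.exp (z * Complex.I)‖ ≤ Real.exp ‖z‖ := by
    refine (Complex.norm_exp_le_exp_norm _).trans (le_of_eq ?_)
    simp
  have h3 := norm_sub_le (Complex.exp (-z * Complex.I)) (Complex.exp (z * Complex.I))
  rw [norm_div, norm_mul, Complex.norm_I, mul_one, Complex.norm_ofNat]
  linarith

/-- With the bound for `completedRiemannZeta₀`, this supplies the a priori finite order of `(s - 1)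
ζ(s)` that Phragmén–Lindelöf requires. -/
theorem exists_norm_inv_Gamma_le :
    ∃ C : ℝ, 0 ≤ C ∧ ∀ w : ℂ, |w.re| ≤ 1 → 1 / 2 ≤ |w.im| →
      ‖(Complex.Gamma w)⁻¹‖ ≤ C * Real.exp (4 * (‖w‖ + 1)) := by
  obtain ⟨D, hD⟩ : ∃ D, ∀ x ∈ Set.Icc (1 : ℝ) 3, ‖Real.Gamma x‖ ≤ D := by
    refine isCompact_Icc.exists_bound_of_continuousOn fun x hx => ?_
    refine (Real.differentiableAt_Gamma fun m h => ?_).continuousAt.continuousWithinAt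
    have := hx.1
    have : (0 : ℝ) ≤ m := m.cast_nonneg
    linarith
  have hD0 : 0 ≤ D := (norm_nonneg _).trans (hD 1 (by norm_num))
  refine ⟨2 * D, by positivity, fun w hw him => ?_⟩
  have hre := abs_le.1 hw
  have hwim : w.im ≠ 0 := fun h => by norm_num [h] at him
  have hu : w - 1 ≠ 0 := fun h => hwim (by simpa using congrArg Complex.im h)
  -- Reflection is used at `w - 1` because `2 - w` has real part in `[1, 3]`, where `Γ` is bounded;
  -- `1 - w` could have real part `0`.
  have hG : Complex.Gamma w = (w - 1) * Complex.Gamma (w - 1) := by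
    rw [← Complex.Gamma_add_one _ hu, sub_add_cancel]
  have hGne : Complex.Gamma (2 - w) ≠ 0 :=
    Complex.Gamma_ne_zero_of_re_pos (by simp; linarith)
  have hrefl := Complex.Gamma_mul_Gamma_one_sub (w - 1)
  rw [show 1 - (w - 1) = 2 - w by ring] at hrefl
  have hinv : (Complex.Gamma (w - 1))⁻¹
      = Complex.Gamma (2 - w) * Complex.sin (Real.pi * (w - 1)) / Real.pi := by
    have h1 : (Complex.Gamma (w - 1))⁻¹ * (Complex.Gamma (w - 1) * Complex.Gamma (2 - w))
        = Complex.Gamma (2 - w) := by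
      rw [← mul_assoc, inv_mul_cancel₀, one_mul]
      refine Complex.Gamma_ne_zero fun m h => hwim ?_
      simpa using congrArg Complex.im h
    have hs : Complex.sin (Real.pi * (w - 1)) ≠ 0 := by
      intro h
      rw [h, div_zero, mul_eq_zero] at hrefl
      refine hrefl.elim (Complex.Gamma_ne_zero fun m h => hwim ?_) hGne
      simpa using congrArg Complex.im h
    have hpi : (Real.pi : ℂ) ≠ 0 := by exact_mod_cast Real.pi_ne_zero
    rw [eq_div_iff hpi, ← h1, hrefl, mul_assoc, div_mul_cancel₀ _ hs]
  have hn : ‖Complex.Gamma (2 - w)‖ ≤ D := by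
    refine le_trans ?_ ((Real.le_norm_self _).trans (hD (2 - w.re) ⟨by linarith, by linarith⟩))
    have h2 : 0 < (2 - w).re := by simp; linarith
    rw [Complex.Gamma_eq_integral h2, Real.Gamma_eq_integral (by simpa using h2)]
    refine (MeasureTheory.norm_integral_le_integral_norm _).trans (le_of_eq ?_)
    refine MeasureTheory.setIntegral_congr_fun measurableSet_Ioi fun x hx => ?_
    simp only [norm_mul]
    rw [Complex.norm_cpow_eq_rpow_re_of_pos hx, Complex.norm_real,
      Real.norm_of_nonneg (Real.exp_pos _).le]
    simp
  have hsin : ‖Complex.sin (Real.pi * (w - 1))‖ ≤ Real.exp (4 * (‖w‖ + 1)) := by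
    refine (norm_sin_le_exp _).trans (Real.exp_le_exp.2 ?_)
    rw [norm_mul, Complex.norm_real, Real.norm_of_nonneg Real.pi_pos.le]
    have := norm_sub_le w 1
    rw [norm_one] at this
    gcongr
    exact Real.pi_le_four
  have hw1 : ‖(w - 1)⁻¹‖ ≤ 2 := by
    rw [norm_inv, inv_le_comm₀ (norm_pos_iff.2 hu) two_pos]
    have := Complex.abs_im_le_norm (w - 1)
    simp at this
    linarith
  rw [hG, mul_inv, norm_mul, hinv, norm_div, norm_mul, Complex.norm_real,
    Real.norm_of_nonneg Real.pi_pos.le]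
  calc _ ≤ 2 * (D * Real.exp (4 * (‖w‖ + 1)) / 1) := by
        gcongr
        linarith [Real.pi_gt_three]
    _ = _ := by ring

namespace SelbergClass

/-- The data of the functional equation of the Riemann zeta function. -/
noncomputable def riemannZetaData : FEData where
  r := 1
  Q := Real.pi ^ (-(1 / 2) : ℝ)
  lam := fun _ => 1 / 2
  mu := fun _ => 0
  omega := 1
  Q_pos := Real.rpow_pos_of_pos Real.pi_pos _
  lam_pos := fun _ => by norm_num
  mu_re_nonneg := fun _ => by simp
  norm_omega := norm_one

theorem riemannZetaData_gammaFactor (s : ℂ) :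
    riemannZetaData.gammaFactor s = Complex.Gammaℝ s := by
  have hpi : (Real.pi : ℂ) ≠ 0 := by exact_mod_cast Real.pi_ne_zero
  have h1 : ((Real.pi ^ (-(1 / 2) : ℝ) : ℝ) : ℂ) ^ s = (Real.pi : ℂ) ^ (-s / 2) := by
    rw [Complex.ofReal_cpow Real.pi_pos.le, Complex.cpow_def_of_ne_zero (x := (Real.pi : ℂ)) hpi,
      Complex.cpow_def_of_ne_zero (Complex.exp_ne_zero _), ← Complex.ofReal_log Real.pi_pos.le,
      ← Complex.ofReal_mul, ← Complex.ofReal_exp, ← Complex.ofReal_log (Real.exp_pos _).le,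
      Real.log_exp, Complex.cpow_def_of_ne_zero hpi, ← Complex.ofReal_log Real.pi_pos.le]
    congr 1
    push_cast
    ring
  have h2 : riemannZetaData.gammaFactor s = ((Real.pi ^ (-(1 / 2) : ℝ) : ℝ) : ℂ) ^ s
      * ∏ j : Fin 1, Complex.Gamma (((1 / 2 : ℝ) : ℂ) * s + 0) := rfl
  rw [h2, h1, Complex.Gammaℝ_def]
  simp only [Finset.univ_unique, Finset.prod_const, Finset.card_singleton, pow_one]
  congr 2
  push_cast
  ring

theorem Gammaℝ_ne_zero_of_not_isPole {s : ℂ} (hp : ¬ riemannZetaData.IsPole s) :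
    Complex.Gammaℝ s ≠ 0 :=
  riemannZetaData_gammaFactor s ▸ riemannZetaData.gammaFactor_ne_zero hp

theorem riemannZeta_functionalEquation : riemannZetaData.FunctionalEquation riemannZeta := by
  intro s h0 h1 hp hp'
  have hc0 : 1 - conj s ≠ 0 := fun h => h1 (by
    have := congrArg conj (sub_eq_zero.1 h)
    simpa using this.symm)
  have hΛ : ∀ w : ℂ, w ≠ 0 → ¬ riemannZetaData.IsPole w →
      riemannZetaData.gammaFactor w * riemannZeta w = completedRiemannZeta w := by
    intro w hw hwp
    rw [riemannZetaData_gammaFactor, riemannZeta_def_of_ne_zero hw,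
      mul_div_cancel₀ _ (Gammaℝ_ne_zero_of_not_isPole hwp)]
  -- Both factors commute with conjugation, so the Selberg form of the equation is `Λ(s) = Λ(1 -
  -- s)`.
  have hconj : conj (riemannZetaData.gammaFactor (1 - conj s) * riemannZeta (1 - conj s))
      = riemannZetaData.gammaFactor (1 - s) * riemannZeta (1 - s) := by
    have e : 1 - conj s = conj (1 - s) := by simp
    rw [e, map_mul, riemannZeta_conj, Complex.conj_conj, riemannZetaData_gammaFactor,
      riemannZetaData_gammaFactor]
    congr 1
    have hpi : (Real.pi : ℂ).arg ≠ Real.pi := by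
      rw [Complex.arg_ofReal_of_nonneg Real.pi_pos.le]
      exact Real.pi_ne_zero.symm
    have e2 : conj (1 - s) / 2 = conj ((1 - s) / 2) := by
      rw [map_div₀, Complex.conj_ofNat]
    have e3 : -conj (1 - s) / 2 = conj (-(1 - s) / 2) := by
      rw [map_div₀, Complex.conj_ofNat, map_neg]
    rw [Complex.Gammaℝ_def, Complex.Gammaℝ_def, e2, e3, map_mul, Complex.Gamma_conj,
      Complex.conj_conj, ← Complex.conj_cpow _ _ hpi, Complex.conj_ofReal]
  have hp1 : ¬ riemannZetaData.IsPole (1 - s) := by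
    rintro ⟨j, k, h⟩
    refine hp' ⟨j, k, ?_⟩
    have h2 := congrArg conj h
    simpa [riemannZetaData, Complex.conj_ofNat] using h2
  rw [hconj, hΛ s h0 hp, hΛ (1 - s) (sub_ne_zero.2 (Ne.symm h1)) hp1, completedRiemannZeta_one_sub]
  exact (one_mul _).symm

/-- The range `|Re s| ≤ 2` is what `ζ(s - 1)` needs for `-1 ≤ Re s ≤ 3`. -/
theorem exists_norm_riemannZeta_le :
    ∃ (C : ℝ) (N : ℕ), 0 ≤ C ∧
      ∀ s : ℂ, |s.re| ≤ 2 → 1 ≤ |s.im| → ‖riemannZeta s‖ ≤ C * (1 + |s.im|) ^ N := by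
  obtain ⟨M, -, hM⟩ := exists_norm_le_of_LSeriesHasSum (F := riemannZeta) (a := 1)
    fun s hs => LSeriesHasSum_one hs
  obtain ⟨D, hD⟩ := exists_norm_completedRiemannZeta₀_le 2
  obtain ⟨C, hC, hinv⟩ := exists_norm_inv_Gamma_le
  have hD0 : 0 ≤ D := (norm_nonneg _).trans (hD 0 (by simp))
  -- The rate `7` is generous: `s - 1` and `1/Γ(s/2)` contribute `exp ‖s‖` and a multiple of `exp
  -- (2‖s‖)`.
  refine riemannZeta_functionalEquation.exists_norm_le_in_strip (G := riemannZeta₁) (m := 1)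
    (by fun_prop) (fun s hs => ?_) hM le_rfl (A := 1) (a := 7)
    (K := (D + 2) * (4 * (C * Real.exp 4))) (t₁ := 1) zero_le_one (by norm_num) fun s hs him => ?_
  · rw [pow_one, riemannZeta_eq_inv_sub_mul hs, mul_inv_cancel_left₀ (sub_ne_zero.2 hs)]
  · have hne : ∀ x : ℝ, s ≠ x := fun x h => by norm_num [h] at him
    have h0 : s ≠ 0 := by simpa using hne 0
    have h1 : s ≠ 1 := by simpa using hne 1
    have hre := abs_le.1 hs
    have hns : 1 ≤ ‖s‖ := him.trans (Complex.abs_im_le_norm s)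
    have hns1 : 1 ≤ ‖1 - s‖ := him.trans (by simpa using Complex.abs_im_le_norm (1 - s))
    have e : riemannZeta₁ s = (s - 1) * (completedRiemannZeta₀ s - 1 / s - 1 / (1 - s)) *
        ((Real.pi : ℂ) ^ (s / 2) * (Complex.Gamma (s / 2))⁻¹) := by
      have h2 : riemannZeta₁ s = (s - 1) * riemannZeta s := by
        rw [riemannZeta_eq_inv_sub_mul h1, mul_inv_cancel_left₀ (sub_ne_zero.2 h1)]
      rw [h2, riemannZeta_eq_completedRiemannZeta₀ h0, div_eq_mul_inv _ (_ * _), mul_inv,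
        ← Complex.cpow_neg, neg_div, neg_neg]
      ring
    have hA : ‖s - 1‖ ≤ Real.exp ‖s‖ := by
      have := norm_sub_le s 1
      rw [norm_one] at this
      linarith [Real.add_one_le_exp ‖s‖]
    have hB : ‖completedRiemannZeta₀ s - 1 / s - 1 / (1 - s)‖ ≤ D + 2 := by
      have h2 : ‖1 / s‖ ≤ 1 := by rw [norm_div, norm_one]; exact div_le_one_of_le₀ hns (by positivity)
      have h3 : ‖1 / (1 - s)‖ ≤ 1 := by
        rw [norm_div, norm_one]; exact div_le_one_of_le₀ hns1 (by positivity)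
      have h4 := norm_sub_le (completedRiemannZeta₀ s - 1 / s) (1 / (1 - s))
      have h5 := norm_sub_le (completedRiemannZeta₀ s) (1 / s)
      linarith [hD s hs]
    have hP : ‖(Real.pi : ℂ) ^ (s / 2)‖ ≤ 4 := by
      rw [Complex.norm_cpow_eq_rpow_re_of_pos Real.pi_pos]
      calc Real.pi ^ (s / 2).re ≤ Real.pi ^ (1 : ℝ) :=
            Real.rpow_le_rpow_of_exponent_le (by linarith [Real.pi_gt_three]) (by simp; linarith)
        _ ≤ 4 := by rw [Real.rpow_one]; exact Real.pi_le_four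
    have hI := hinv (s / 2) (by simp [abs_div]; linarith) (by simp [abs_div]; linarith)
    rw [e, norm_mul, norm_mul, norm_mul]
    have hs2 : ‖s / 2‖ = ‖s‖ / 2 := by simp
    rw [hs2] at hI
    calc _ ≤ Real.exp ‖s‖ * (D + 2) * (4 * (C * Real.exp (4 * (‖s‖ / 2 + 1)))) := by gcongr
      _ = (D + 2) * (4 * (C * Real.exp 4)) * Real.exp (3 * ‖s‖) := by
        have : Real.exp (4 * (‖s‖ / 2 + 1)) = Real.exp 4 * Real.exp (2 * ‖s‖) := by
          rw [← Real.exp_add]; ring_nf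
        have h3 : Real.exp (3 * ‖s‖) = Real.exp ‖s‖ * Real.exp (2 * ‖s‖) := by
          rw [← Real.exp_add]; ring_nf
        rw [this, h3]; ring
      _ ≤ _ := by
        rw [Real.rpow_one]
        gcongr
        norm_num

end SelbergClass

/-! ### Lower bounds for holomorphic functions away from their zeros. -/

open Metric in
/-- A lower bound of Harnack type for a zero-free holomorphic function on a disc. -/
theorem exp_neg_le_norm_of_ne_zero_on_ball {h : ℂ → ℂ} {c : ℂ} {r L : ℝ} (hL : 0 < L)
    (hd : DifferentiableOn ℂ h (ball c r)) (h0 : ∀ z ∈ ball c r, h z ≠ 0) (hc : h c = 1)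
    (hb : ∀ z ∈ ball c r, ‖h z‖ ≤ Real.exp L) {z : ℂ} (hz : ‖z - c‖ ≤ r / 2) (hr : 0 < r) :
    Real.exp (-(2 * L)) ≤ ‖h z‖ := by
  have hopen : IsOpen (ball c r) := isOpen_ball
  have hquot : DifferentiableOn ℂ (fun z => deriv h z / h z) (ball c r) :=
    (hd.deriv hopen).div hd h0
  -- A primitive of `h'/h` gives a logarithm of `h`; its real part is at most `L`, so
  -- Borel–Carathéodory bounds its modulus by `2L` on the half-radius disc.
  obtain ⟨g, hg⟩ := hquot.isExactOn_ball
  have hcm : c ∈ ball c r := mem_ball_self hr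
  have hexp : ∀ w ∈ ball c r, h w = Complex.exp (g w - g c) := by
    intro w hw
    have hder : ∀ w ∈ ball c r, HasDerivWithinAt (fun w => h w * Complex.exp (-g w)) 0
        (ball c r) w := by
      intro w hw
      have h1 := (hd.differentiableAt (hopen.mem_nhds hw)).hasDerivAt
      have h2 := h1.mul (hg w hw).neg.cexp
      refine (h2.congr_deriv ?_).hasDerivWithinAt
      have := h0 w hw
      field_simp
      ring
    have hconst := (convex_ball c r).norm_image_sub_le_of_norm_hasDerivWithin_le (C := 0) hder
      (fun _ _ => by simp) hcm hw
    rw [zero_mul, norm_le_zero_iff, sub_eq_zero, hc, one_mul] at hconst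
    rw [sub_eq_add_neg, Complex.exp_add, ← hconst,
      mul_left_comm, ← Complex.exp_add, add_neg_cancel, Complex.exp_zero, mul_one]
  have hnorm : ∀ w ∈ ball c r, ‖h w‖ = Real.exp (g w - g c).re := fun w hw => by
    rw [hexp w hw, Complex.norm_exp]
  have hmem : ∀ w ∈ ball (0 : ℂ) r, c + w ∈ ball c r := fun w hw => by
    simpa [mem_ball, dist_eq_norm] using hw
  have hzr : ‖z - c‖ < r := by linarith
  have hBC := Complex.borelCaratheodory_zero (f := fun w => g (c + w) - g c) (z := z - c) hL
    (fun w hw => by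
      refine DifferentiableAt.differentiableWithinAt (DifferentiableAt.sub_const ?_ _)
      exact (hg _ (hmem w hw)).differentiableAt.comp w (by fun_prop))
    (fun w hw => by
      have h1 := hb _ (hmem w hw)
      rw [hnorm _ (hmem w hw)] at h1
      exact Real.exp_le_exp.1 h1)
    hr (by simpa [mem_ball, dist_eq_norm] using hzr) (by simp)
  simp only [add_sub_cancel] at hBC
  rw [hnorm z (by simpa [mem_ball, dist_eq_norm] using hzr)]
  refine Real.exp_le_exp.2 ?_
  have h1 : 2 * L * ‖z - c‖ / (r - ‖z - c‖) ≤ 2 * L := by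
    rw [div_le_iff₀ (by linarith)]
    gcongr
    linarith
  have h2 := (Complex.abs_re_le_norm _).trans (hBC.trans h1)
  exact (abs_le.1 h2).1

/-- Dividing out one zero by `dslope` keeps the other zeros, since the points of `S` are distinct.
-/
theorem exists_eq_mul_prod_sub_of_zeros {U : Set ℂ} (hU : IsOpen U) (S : Finset ℂ) :
    ∀ {f : ℂ → ℂ}, DifferentiableOn ℂ f U → (∀ ρ ∈ S, ρ ∈ U ∧ f ρ = 0) →
    ∃ g : ℂ → ℂ, DifferentiableOn ℂ g U ∧ ∀ z, f z = g z * ∏ ρ ∈ S, (z - ρ) := by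
  classical
  induction S using Finset.induction_on with
  | empty => exact fun {f} hf _ => ⟨f, hf, fun z => by simp⟩
  | insert a S ha ih =>
    intro f hf hS
    have hfa := hS a (Finset.mem_insert_self a S)
    have hds : ∀ z, f z = (z - a) * dslope f a z := fun z => by
      have := sub_smul_dslope f a z
      rw [hfa.2, sub_zero, smul_eq_mul] at this
      exact this.symm
    obtain ⟨g, hg, hfg⟩ := ih
      ((Complex.differentiableOn_dslope (hU.mem_nhds hfa.1)).2 hf) fun ρ hρ => by
        refine ⟨(hS ρ (Finset.mem_insert_of_mem hρ)).1, ?_⟩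
        have h1 := hds ρ
        rw [(hS ρ (Finset.mem_insert_of_mem hρ)).2, eq_comm, mul_eq_zero, sub_eq_zero] at h1
        exact h1.resolve_left fun h => ha (h ▸ hρ)
    refine ⟨g, hg, fun z => ?_⟩
    rw [Finset.prod_insert ha, hds z, hfg z]
    ring

open Metric in
/-- A holomorphic function with only simple zeros, bounded by `M` times its value at the centre of
a disc, has few zeros in a smaller disc and is bounded below in terms of the distances to them. -/
theorem card_zeros_le_and_le_norm {f : ℂ → ℂ} {U : Set ℂ} (hU : IsOpen U)
    (hf : DifferentiableOn ℂ f U) {c : ℂ} {r M : ℝ} (hr : 0 < r) (hM : 1 < M)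
    (hcU : closedBall c (3 * r) ⊆ U) (hc : f c ≠ 0)
    (hfM : ∀ z ∈ closedBall c (3 * r), ‖f z‖ ≤ M * ‖f c‖) {S : Finset ℂ}
    (hS : ∀ ρ ∈ S, ρ ∈ ball c r ∧ f ρ = 0 ∧ deriv f ρ ≠ 0)
    (hS' : ∀ z ∈ ball c r, f z = 0 → z ∈ S) :
    2 ^ S.card ≤ M ∧ ∀ z : ℂ, ‖z - c‖ ≤ r / 2 →
      ‖f c‖ * Real.exp (-(2 * Real.log M)) * ∏ ρ ∈ S, (‖z - ρ‖ / r) ≤ ‖f z‖ := by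
  have hb3 : ball c r ⊆ closedBall c (3 * r) :=
    ball_subset_closedBall.trans (closedBall_subset_closedBall (by linarith))
  obtain ⟨g, hg, hfg⟩ := exists_eq_mul_prod_sub_of_zeros hU S hf
    fun ρ hρ => ⟨hcU (hb3 (hS ρ hρ).1), (hS ρ hρ).2.1⟩
  have hcm : c ∈ ball c r := mem_ball_self hr
  -- Simplicity enters here: a zero of `g` in the ball would be a multiple zero of `f`.
  have hg0 : ∀ z ∈ ball c r, g z ≠ 0 := by
    intro z hz h
    have hfz : f z = 0 := by rw [hfg z, h, zero_mul]
    have hzS := hS' z hz hfz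
    refine (hS z hzS).2.2 ?_
    have h1 : HasDerivAt g (deriv g z) z :=
      (hg.differentiableAt (hU.mem_nhds (hcU (hb3 hz)))).hasDerivAt
    have h2 : DifferentiableAt ℂ (fun z => ∏ ρ ∈ S, (z - ρ)) z := by fun_prop
    have h3 := h1.mul h2.hasDerivAt
    have h4 : (g * fun z => ∏ ρ ∈ S, (z - ρ)) = f := funext fun w => (hfg w).symm
    rw [h4] at h3
    rw [h3.deriv, h, Finset.prod_eq_zero hzS (sub_self z)]
    simp
  have hgc : 0 < ‖g c‖ := norm_pos_iff.2 (hg0 c hcm)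
  have hfc : 0 < ‖f c‖ := norm_pos_iff.2 hc
  set h : ℂ → ℂ := fun z => g z / g c with hh
  have hnormf : ∀ z, ‖f z‖ = ‖g z‖ * ∏ ρ ∈ S, ‖z - ρ‖ := fun z => by
    rw [hfg z, norm_mul, norm_prod]
  have hdist : ∀ ρ ∈ S, ‖c - ρ‖ ≤ r := fun ρ hρ => by
    have := (hS ρ hρ).1
    rw [mem_ball, dist_eq_norm, norm_sub_rev] at this
    exact this.le
  have hcprod : ∏ ρ ∈ S, ‖c - ρ‖ ≤ r ^ S.card :=
    (Finset.prod_le_prod (fun _ _ => norm_nonneg _) hdist).trans_eq (Finset.prod_const r)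
  have hfc_le : ‖f c‖ ≤ ‖g c‖ * r ^ S.card := by
    rw [hnormf c]
    gcongr
  -- On the circle of radius `3r` each `|z - ρ| ≥ 2r`, while `|c - ρ| ≤ r`: every zero gains a
  -- factor `2`. With `h c = 1` the maximum principle then limits the number of zeros.
  have hfront : ∀ z ∈ frontier (ball c (3 * r)), ‖h z‖ ≤ M / 2 ^ S.card := by
    intro z hz
    have hz' : z ∈ sphere c (3 * r) := frontier_ball_subset_sphere hz
    rw [mem_sphere, dist_eq_norm] at hz'
    have hge : (2 * r) ^ S.card ≤ ∏ ρ ∈ S, ‖z - ρ‖ := by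
      rw [← Finset.prod_const]
      refine Finset.prod_le_prod (fun _ _ => by positivity) fun ρ hρ => ?_
      have h1 := norm_sub_le_norm_sub_add_norm_sub z ρ c
      rw [norm_sub_rev ρ c] at h1
      linarith [hdist ρ hρ]
    have h1 : ‖f z‖ ≤ M * ‖f c‖ := hfM z (by simp [mem_closedBall, dist_eq_norm, hz'])
    have h2 : ‖g z‖ * (2 * r) ^ S.card ≤ M * (‖g c‖ * r ^ S.card) := by
      calc _ ≤ ‖g z‖ * ∏ ρ ∈ S, ‖z - ρ‖ := by gcongr
        _ = ‖f z‖ := (hnormf z).symm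
        _ ≤ M * ‖f c‖ := h1
        _ ≤ _ := by gcongr
    simp only [hh, norm_div]
    rw [div_le_div_iff₀ hgc (by positivity)]
    have h3 : 0 < r ^ S.card := by positivity
    refine le_of_mul_le_mul_right ?_ h3
    calc _ = ‖g z‖ * (2 * r) ^ S.card := by rw [mul_pow]; ring
      _ ≤ _ := h2
      _ = _ := by ring
  have hhd : DifferentiableOn ℂ h U := hg.div_const _
  have hcl : closure (ball c (3 * r)) = closedBall c (3 * r) := closure_ball c (by positivity)
  have hmax : ∀ z ∈ closedBall c (3 * r), ‖h z‖ ≤ M / 2 ^ S.card := fun z hz =>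
    Complex.norm_le_of_forall_mem_frontier_norm_le isBounded_ball
      ((hhd.mono (by rw [hcl]; exact hcU)).diffContOnCl) hfront (by rwa [hcl])
  have hhc : h c = 1 := div_self (hg0 c hcm)
  have hcard : 2 ^ S.card ≤ M := by
    have h1 := hmax c (hb3 hcm)
    rw [hhc, norm_one, le_div_iff₀ (by positivity), one_mul] at h1
    exact h1
  refine ⟨hcard, fun z hz => ?_⟩
  have hlow := exp_neg_le_norm_of_ne_zero_on_ball (h := h) (c := c) (r := r) (Real.log_pos hM)
    (hhd.mono (hb3.trans hcU)) (fun z hz => div_ne_zero (hg0 z hz) (hg0 c hcm)) hhc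
    (fun z hz => by
      rw [Real.exp_log (by linarith)]
      exact (hmax z (hb3 hz)).trans (div_le_self (by linarith) (one_le_pow₀ one_le_two)))
    hz hr
  have hrp : 0 < r ^ S.card := by positivity
  rw [Finset.prod_div_distrib, Finset.prod_const, ← mul_div_assoc, div_le_iff₀ hrp]
  have hgz : ‖g z‖ = ‖h z‖ * ‖g c‖ := by
    simp only [hh, norm_div]
    rw [div_mul_cancel₀ _ hgc.ne']
  rw [hnormf z, hgz]
  calc _ ≤ (‖g c‖ * r ^ S.card) * ‖h z‖ * ∏ ρ ∈ S, ‖z - ρ‖ := by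
        gcongr
    _ = _ := by ring

/-- Pigeonhole on the midpoints of `N + 1` equal subintervals: they are `1/(N+1)` apart, so no point
of `S` is within `1/(2(N+1))` of two of them. -/
theorem exists_mem_Icc_le_abs_sub (S : Finset ℝ) (a : ℝ) :
    ∃ t ∈ Set.Icc a (a + 1), ∀ x ∈ S, 1 / (2 * ((S.card : ℝ) + 1)) ≤ |t - x| := by
  set N := S.card
  have hN : (0 : ℝ) < N + 1 := by positivity
  set t : ℕ → ℝ := fun k => a + (2 * k + 1) / (2 * (N + 1)) with ht
  have hmem : ∀ k ∈ Finset.range (N + 1), t k ∈ Set.Icc a (a + 1) := by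
    intro k hk
    have hk1 : (k : ℝ) ≤ N := by
      have := Finset.mem_range.1 hk
      exact_mod_cast Nat.lt_succ_iff.1 this
    refine ⟨le_add_of_nonneg_right (by positivity), ?_⟩
    simp only [ht]
    gcongr
    rw [div_le_one (by positivity)]
    linarith
  by_contra! hcon
  choose! x hxS hx using fun k (hk : k ∈ Finset.range (N + 1)) => hcon (t k) (hmem k hk)
  obtain ⟨k, hk, l, hl, hkl, hxx⟩ := Finset.exists_ne_map_eq_of_card_lt_of_maps_to
    (s := Finset.range (N + 1)) (t := S) (by simp [N]) hxS
  have h1 := hx k hk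
  have h2 := hx l hl
  rw [hxx] at h1
  have h3 : |t k - t l| < 1 / (N + 1) := by
    have h4 := abs_sub_le (t k) (x l) (t l)
    rw [abs_sub_comm (x l) (t l)] at h4
    have h5 : 1 / (2 * ((N : ℝ) + 1)) + 1 / (2 * ((N : ℝ) + 1)) = 1 / (N + 1) := by
      field_simp; norm_num
    linarith
  have h6 : t k - t l = ((k : ℝ) - l) / (N + 1) := by
    simp only [ht]
    field_simp
    ring
  rw [h6, abs_div, abs_of_pos hN, div_lt_div_iff_of_pos_right hN] at h3
  have h7 : |((k : ℤ) - l : ℤ)| < 1 := by exact_mod_cast h3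
  rw [Int.abs_lt_one_iff] at h7
  exact hkl (by omega)

/-! ### The residue theorem for rectangles. -/

/-- The integral of `f` over the positively oriented boundary of `[a, b] × [c, d]`. -/
noncomputable def rectangleIntegral (f : ℂ → ℂ) (a b c d : ℝ) : ℂ :=
  (∫ x : ℝ in a..b, f (x + c * Complex.I)) - (∫ x : ℝ in a..b, f (x + d * Complex.I)) +
    Complex.I • (∫ y : ℝ in c..d, f (b + y * Complex.I)) -
    Complex.I • (∫ y : ℝ in c..d, f (a + y * Complex.I))

/-- The boundary of the rectangle `[a, b] × [c, d]`. -/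
def rectangleBoundary (a b c d : ℝ) : Set ℂ :=
  (Set.Icc a b ×ℂ Set.Icc c d) \ (Set.Ioo a b ×ℂ Set.Ioo c d)

section Rectangle

variable {a b c d : ℝ}

theorem mem_rectangleBoundary_of_im {x y : ℝ} (hcd : c ≤ d) (hx : x ∈ Set.Icc a b)
    (hy : y = c ∨ y = d) : (x + y * Complex.I : ℂ) ∈ rectangleBoundary a b c d := by
  refine ⟨⟨by simpa using hx, ?_⟩, fun h => ?_⟩
  · rcases hy with rfl | rfl <;> simpa using hcd
  · have := h.2
    rcases hy with rfl | rfl <;> simp at this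

theorem mem_rectangleBoundary_of_re {x y : ℝ} (hab : a ≤ b) (hy : y ∈ Set.Icc c d)
    (hx : x = a ∨ x = b) : (x + y * Complex.I : ℂ) ∈ rectangleBoundary a b c d := by
  refine ⟨⟨?_, by simpa using hy⟩, fun h => ?_⟩
  · rcases hx with rfl | rfl <;> simpa using hab
  · have := h.1
    rcases hx with rfl | rfl <;> simp at this

theorem norm_rectangleIntegral_le (hab : a ≤ b) (hcd : c ≤ d) {f : ℂ → ℂ} {M : ℝ}
    (h : ∀ s ∈ rectangleBoundary a b c d, ‖f s‖ ≤ M) :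
    ‖rectangleIntegral f a b c d‖ ≤ M * (2 * (b - a) + 2 * (d - c)) := by
  have hIoc : ∀ {p q t : ℝ}, p ≤ q → t ∈ Set.uIoc p q → t ∈ Set.Icc p q := fun hpq ht =>
    Set.Ioc_subset_Icc_self (Set.uIoc_of_le hpq ▸ ht)
  have h1 := intervalIntegral.norm_integral_le_of_norm_le_const (a := a) (b := b)
    (f := fun x : ℝ => f (x + c * Complex.I)) (C := M)
    fun x hx => h _ (mem_rectangleBoundary_of_im hcd (hIoc hab hx) (Or.inl rfl))
  have h2 := intervalIntegral.norm_integral_le_of_norm_le_const (a := a) (b := b)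
    (f := fun x : ℝ => f (x + d * Complex.I)) (C := M)
    fun x hx => h _ (mem_rectangleBoundary_of_im hcd (hIoc hab hx) (Or.inr rfl))
  have h3 := intervalIntegral.norm_integral_le_of_norm_le_const (a := c) (b := d)
    (f := fun y : ℝ => f (b + y * Complex.I)) (C := M)
    fun x hx => h _ (mem_rectangleBoundary_of_re hab (hIoc hcd hx) (Or.inr rfl))
  have h4 := intervalIntegral.norm_integral_le_of_norm_le_const (a := c) (b := d)
    (f := fun y : ℝ => f (a + y * Complex.I)) (C := M)
    fun x hx => h _ (mem_rectangleBoundary_of_re hab (hIoc hcd hx) (Or.inl rfl))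
  rw [abs_of_nonneg (sub_nonneg.2 hab)] at h1 h2
  rw [abs_of_nonneg (sub_nonneg.2 hcd)] at h3 h4
  unfold rectangleIntegral
  refine (norm_sub_le _ _).trans ?_
  rw [norm_smul, Complex.norm_I, one_mul]
  have h5 := norm_add_le ((∫ x : ℝ in a..b, f (x + c * Complex.I)) -
    (∫ x : ℝ in a..b, f (x + d * Complex.I))) (Complex.I • (∫ y : ℝ in c..d, f (b + y * Complex.I)))
  rw [norm_smul, Complex.norm_I, one_mul] at h5
  have h6 := norm_sub_le (∫ x : ℝ in a..b, f (x + c * Complex.I))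
    (∫ x : ℝ in a..b, f (x + d * Complex.I))
  linarith

theorem rectangleIntegral_congr (hab : a ≤ b) (hcd : c ≤ d) {f g : ℂ → ℂ}
    (h : Set.EqOn f g (rectangleBoundary a b c d)) :
    rectangleIntegral f a b c d = rectangleIntegral g a b c d := by
  unfold rectangleIntegral
  congr 1
  · congr 1
    · congr 1 <;> refine intervalIntegral.integral_congr fun x hx => h ?_
      · exact mem_rectangleBoundary_of_im hcd (Set.uIcc_of_le hab ▸ hx) (Or.inl rfl)
      · exact mem_rectangleBoundary_of_im hcd (Set.uIcc_of_le hab ▸ hx) (Or.inr rfl)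
    · congr 1
      refine intervalIntegral.integral_congr fun x hx => h ?_
      exact mem_rectangleBoundary_of_re hab (Set.uIcc_of_le hcd ▸ hx) (Or.inr rfl)
  · congr 1
    refine intervalIntegral.integral_congr fun x hx => h ?_
    exact mem_rectangleBoundary_of_re hab (Set.uIcc_of_le hcd ▸ hx) (Or.inl rfl)

theorem rectangleIntegral_add_const_mul (hab : a ≤ b) (hcd : c ≤ d) {f g : ℂ → ℂ} (k : ℂ)
    (hf : ContinuousOn f (rectangleBoundary a b c d))
    (hg : ContinuousOn g (rectangleBoundary a b c d)) :
    rectangleIntegral (fun s => f s + k * g s) a b c d =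
      rectangleIntegral f a b c d + k * rectangleIntegral g a b c d := by
  have him : ∀ {u : ℂ → ℂ} {y : ℝ}, ContinuousOn u (rectangleBoundary a b c d) → y = c ∨ y = d →
      IntervalIntegrable (fun x : ℝ => u (x + y * Complex.I)) MeasureTheory.volume a b := by
    intro u y hu hy
    refine ContinuousOn.intervalIntegrable (hu.comp (by fun_prop) fun x hx => ?_)
    exact mem_rectangleBoundary_of_im hcd (Set.uIcc_of_le hab ▸ hx) hy
  have hre : ∀ {u : ℂ → ℂ} {x : ℝ}, ContinuousOn u (rectangleBoundary a b c d) → x = a ∨ x = b →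
      IntervalIntegrable (fun y : ℝ => u (x + y * Complex.I)) MeasureTheory.volume c d := by
    intro u x hu hx
    refine ContinuousOn.intervalIntegrable (hu.comp (by fun_prop) fun y hy => ?_)
    exact mem_rectangleBoundary_of_re hab (Set.uIcc_of_le hcd ▸ hy) hx
  unfold rectangleIntegral
  rw [intervalIntegral.integral_add (him hf (Or.inl rfl)) ((him hg (Or.inl rfl)).const_mul k),
    intervalIntegral.integral_add (him hf (Or.inr rfl)) ((him hg (Or.inr rfl)).const_mul k),
    intervalIntegral.integral_add (hre hf (Or.inl rfl)) ((hre hg (Or.inl rfl)).const_mul k),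
    intervalIntegral.integral_add (hre hf (Or.inr rfl)) ((hre hg (Or.inr rfl)).const_mul k)]
  simp only [intervalIntegral.integral_const_mul, smul_eq_mul]
  ring

theorem rectangleIntegral_eq_zero (hab : a ≤ b) (hcd : c ≤ d) {f : ℂ → ℂ}
    (hf : ∀ s ∈ Set.Icc a b ×ℂ Set.Icc c d, DifferentiableAt ℂ f s) :
    rectangleIntegral f a b c d = 0 := by
  have h := Complex.integral_boundary_rect_eq_zero_of_differentiableOn f (a + c * Complex.I)
    (b + d * Complex.I) fun s hs => (hf s (by simpa [Set.uIcc_of_le hab, Set.uIcc_of_le hcd]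
      using hs)).differentiableWithinAt
  simpa [rectangleIntegral] using h

/-- `log(s - ρ)` is a primitive on three edges; the left edge crosses the branch cut, so `log(-(s -
ρ))` is used there. The mismatches of `πi` at its two ends add up to `2πi`. -/
theorem rectangleIntegral_inv_sub {ρ : ℂ} (hρ : ρ ∈ Set.Ioo a b ×ℂ Set.Ioo c d) :
    rectangleIntegral (fun s => (s - ρ)⁻¹) a b c d = 2 * Real.pi * Complex.I := by
  obtain ⟨⟨ha, hb⟩, ⟨hc, hd⟩⟩ := hρ
  have hor : ∀ y : ℝ, y ≠ ρ.im → (∫ x : ℝ in a..b, ((x + y * Complex.I : ℂ) - ρ)⁻¹) =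
      Complex.log (b + y * Complex.I - ρ) - Complex.log (a + y * Complex.I - ρ) := by
    intro y hy
    have him : ∀ x : ℝ, ((x + y * Complex.I : ℂ) - ρ).im ≠ 0 := fun x => by
      simpa [sub_eq_zero] using hy
    refine intervalIntegral.integral_eq_sub_of_hasDerivAt
      (f := fun x : ℝ => Complex.log ((x + y * Complex.I : ℂ) - ρ)) (fun x _ => ?_) ?_
    · have h1 : HasDerivAt (fun x : ℝ => (x + y * Complex.I : ℂ) - ρ) 1 x :=
        ((Complex.ofRealCLM.hasDerivAt (x := x)).add_const _).sub_const _
      simpa using h1.clog_real (Or.inr (him x))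
    · refine ContinuousOn.intervalIntegrable (ContinuousOn.inv₀ (by fun_prop) fun x _ h => ?_)
      exact him x (by rw [h]; simp)
  have vder : ∀ x y : ℝ, HasDerivAt (fun y : ℝ => (x + y * Complex.I : ℂ) - ρ) Complex.I y :=
    fun x y => by
      simpa using (((Complex.ofRealCLM.hasDerivAt (x := y)).mul_const Complex.I).const_add
        (x : ℂ)).sub_const ρ
  have hcont : ∀ x : ℝ, x ≠ ρ.re → IntervalIntegrable
      (fun y : ℝ => Complex.I * ((x + y * Complex.I : ℂ) - ρ)⁻¹) MeasureTheory.volume c d := by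
    intro x hx
    refine ContinuousOn.intervalIntegrable
      (continuousOn_const.mul (ContinuousOn.inv₀ (by fun_prop) fun y _ h => hx ?_))
    simpa [sub_eq_zero] using congrArg Complex.re h
  have hright : Complex.I • (∫ y : ℝ in c..d, ((b + y * Complex.I : ℂ) - ρ)⁻¹) =
      Complex.log (b + d * Complex.I - ρ) - Complex.log (b + c * Complex.I - ρ) := by
    rw [smul_eq_mul, ← intervalIntegral.integral_const_mul]
    refine intervalIntegral.integral_eq_sub_of_hasDerivAt
      (f := fun y : ℝ => Complex.log ((b + y * Complex.I : ℂ) - ρ)) (fun y _ => ?_)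
      (hcont b hb.ne')
    have h1 := (vder b y).clog_real (Or.inl (by simpa using hb))
    rwa [div_eq_mul_inv] at h1
  have hleft : Complex.I • (∫ y : ℝ in c..d, ((a + y * Complex.I : ℂ) - ρ)⁻¹) =
      Complex.log (-(a + d * Complex.I - ρ)) - Complex.log (-(a + c * Complex.I - ρ)) := by
    rw [smul_eq_mul, ← intervalIntegral.integral_const_mul]
    refine intervalIntegral.integral_eq_sub_of_hasDerivAt
      (f := fun y : ℝ => Complex.log (-((a + y * Complex.I : ℂ) - ρ))) (fun y _ => ?_)
      (hcont a ha.ne)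
    have h1 := (vder a y).neg.clog_real (Or.inl (by simpa using ha))
    rwa [Pi.neg_apply, neg_div_neg_eq, div_eq_mul_inv] at h1
  have hlogd : Complex.log (-(a + d * Complex.I - ρ)) =
      Complex.log (a + d * Complex.I - ρ) - Real.pi * Complex.I := by
    have him : 0 < (a + d * Complex.I - ρ).im := by simpa using hd
    simp only [Complex.log, norm_neg, Complex.arg_neg_eq_arg_sub_pi_of_im_pos him]
    push_cast
    ring
  have hlogc : Complex.log (-(a + c * Complex.I - ρ)) =
      Complex.log (a + c * Complex.I - ρ) + Real.pi * Complex.I := by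
    have him : (a + c * Complex.I - ρ).im < 0 := by simpa using hc
    simp only [Complex.log, norm_neg, Complex.arg_neg_eq_arg_add_pi_of_im_neg him]
    push_cast
    ring
  unfold rectangleIntegral
  rw [hor c hc.ne, hor d hd.ne', hright, hleft, hlogd, hlogc]
  ring

/-- The residue theorem for a rectangle and a function with simple poles. -/
theorem rectangleIntegral_eq_sum_residues (hab : a ≤ b) (hcd : c ≤ d) (res : ℂ → ℂ)
    (S : Finset ℂ) : ∀ {f : ℂ → ℂ}, (∀ ρ ∈ S, ρ ∈ Set.Ioo a b ×ℂ Set.Ioo c d) →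
    (∀ s ∈ Set.Icc a b ×ℂ Set.Icc c d, s ∉ S → DifferentiableAt ℂ f s) →
    (∀ ρ ∈ S, ∃ h : ℂ → ℂ, DifferentiableAt ℂ h ρ ∧
      ∀ᶠ s in 𝓝[≠] ρ, f s = h s + res ρ * (s - ρ)⁻¹) →
    rectangleIntegral f a b c d = 2 * Real.pi * Complex.I * ∑ ρ ∈ S, res ρ := by
  classical
  induction S using Finset.induction_on with
  | empty =>
    intro f _ hf _
    simpa using rectangleIntegral_eq_zero hab hcd fun s hs => hf s hs (by simp)
  | insert p S hp ih =>
    intro f hS hf hres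
    obtain ⟨h, hhd, hh⟩ := hres p (Finset.mem_insert_self p S)
    have hpS := hS p (Finset.mem_insert_self p S)
    -- Subtracting the principal part at `p` removes the singularity once the value at `p` is
    -- corrected.
    set f₁ : ℂ → ℂ := Function.update (fun s => f s - res p * (s - p)⁻¹) p (h p) with hf₁
    have hf₁p : f₁ =ᶠ[𝓝 p] h := by
      rw [eventually_nhdsWithin_iff] at hh
      filter_upwards [hh] with s hs
      by_cases hsp : s = p
      · rw [hsp, hf₁, Function.update_self]
      · rw [hf₁, Function.update_of_ne hsp, hs hsp, add_sub_cancel_right]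
    have hf₁ne : ∀ q, q ≠ p → f₁ =ᶠ[𝓝 q] fun s => f s - res p * (s - p)⁻¹ := fun q hq => by
      filter_upwards [isOpen_ne.mem_nhds hq] with s hs
      exact Function.update_of_ne hs _ _
    have hinv : ∀ q, q ≠ p → DifferentiableAt ℂ (fun s => res p * (s - p)⁻¹) q := fun q hq => by
      have := sub_ne_zero.2 hq
      fun_prop (disch := assumption)
    have hdiff : ∀ s ∈ Set.Icc a b ×ℂ Set.Icc c d, s ∉ S → DifferentiableAt ℂ f₁ s := by
      intro s hs hsS
      by_cases hsp : s = p
      · subst hsp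
        exact hhd.congr_of_eventuallyEq hf₁p
      · refine DifferentiableAt.congr_of_eventuallyEq ?_ (hf₁ne s hsp)
        exact (hf s hs (by simp [hsp, hsS])).sub (hinv s hsp)
    have hI := ih (f := f₁) (fun ρ hρ => hS ρ (Finset.mem_insert_of_mem hρ)) hdiff fun ρ hρ => by
      have hne : ρ ≠ p := fun h => hp (h ▸ hρ)
      obtain ⟨u, hud, hu⟩ := hres ρ (Finset.mem_insert_of_mem hρ)
      refine ⟨fun s => u s - res p * (s - p)⁻¹, hud.sub (hinv ρ hne), ?_⟩
      filter_upwards [hu, (hf₁ne ρ hne).filter_mono nhdsWithin_le_nhds] with s hs1 hs2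
      rw [hs2, hs1]
      ring
    have hbd : ∀ s ∈ rectangleBoundary a b c d, s ∉ S ∧ s ≠ p := fun s hs =>
      ⟨fun h => hs.2 (hS s (Finset.mem_insert_of_mem h)), fun h => hs.2 (h ▸ hpS)⟩
    have e : rectangleIntegral f a b c d =
        rectangleIntegral (fun s => f₁ s + res p * (s - p)⁻¹) a b c d := by
      refine rectangleIntegral_congr hab hcd fun s hs => ?_
      simp only [hf₁, Function.update_of_ne (hbd s hs).2, sub_add_cancel]
    rw [e, rectangleIntegral_add_const_mul hab hcd, hI, rectangleIntegral_inv_sub hpS,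
      Finset.sum_insert hp]
    · ring
    · exact fun s hs => (hdiff s hs.1 (hbd s hs).1).continuousAt.continuousWithinAt
    · refine ContinuousOn.inv₀ (by fun_prop) fun s hs => sub_ne_zero.2 (hbd s hs).2

end Rectangle

/-- Writing `F s = (s - ρ) D(s)` with `D(ρ) = F'(ρ) ≠ 0`, the quotient `k/D` is holomorphic near
`ρ`, and its own divided difference is the regular part. -/
theorem exists_eventually_div_eq_add_residue {U : Set ℂ} (hU : IsOpen U) {k F : ℂ → ℂ}
    (hk : DifferentiableOn ℂ k U) (hF : DifferentiableOn ℂ F U) {ρ : ℂ} (hρ : ρ ∈ U)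
    (h0 : F ρ = 0) (h1 : deriv F ρ ≠ 0) :
    ∃ h : ℂ → ℂ, DifferentiableAt ℂ h ρ ∧
      ∀ᶠ s in 𝓝[≠] ρ, k s / F s = h s + k ρ / deriv F ρ * (s - ρ)⁻¹ := by
  have hD : DifferentiableOn ℂ (dslope F ρ) U :=
    (Complex.differentiableOn_dslope (hU.mem_nhds hρ)).2 hF
  have hDρ : dslope F ρ ρ = deriv F ρ := dslope_same F ρ
  set V : Set ℂ := U ∩ dslope F ρ ⁻¹' {0}ᶜ with hV
  have hVo : IsOpen V := hD.continuousOn.isOpen_inter_preimage hU isOpen_compl_singleton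
  have hρV : ρ ∈ V := ⟨hρ, by simpa [hDρ] using h1⟩
  have hq : DifferentiableOn ℂ (fun s => k s / dslope F ρ s) V :=
    (hk.mono Set.inter_subset_left).div (hD.mono Set.inter_subset_left) fun s hs => hs.2
  refine ⟨dslope (fun s => k s / dslope F ρ s) ρ,
    ((Complex.differentiableOn_dslope (hVo.mem_nhds hρV)).2 hq).differentiableAt
      (hVo.mem_nhds hρV), ?_⟩
  filter_upwards [self_mem_nhdsWithin, nhdsWithin_le_nhds (hVo.mem_nhds hρV)] with s hs hsV
  have hsρ : s - ρ ≠ 0 := sub_ne_zero.2 hs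
  have hsV' : dslope F ρ s ≠ 0 := hsV.2
  have hFs : F s = (s - ρ) * dslope F ρ s := by
    have := sub_smul_dslope F ρ s
    rw [h0, sub_zero, smul_eq_mul] at this
    exact this.symm
  rw [dslope_of_ne _ hs, slope_def_field, hDρ, hFs]
  field_simp
  ring

/-! ### Location of the zeros and choice of the heights. -/

namespace SelbergClass

variable {F : ℂ → ℂ} {g : FEData}

theorem IsSelberg.differentiableAt (hF : IsSelberg F) {s : ℂ} (hs : s ≠ 1) :
    DifferentiableAt ℂ F s := by
  obtain ⟨m, G, ⟨hG, -⟩, hFG⟩ := hF.continuation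
  have h1 : F =ᶠ[𝓝 s] fun s => G s / (s - 1) ^ m := by
    filter_upwards [isOpen_ne.mem_nhds hs] with w hw
    rw [← hFG w hw, mul_div_cancel_left₀ _ (pow_ne_zero m (sub_ne_zero.2 hw))]
  have h2 : DifferentiableAt ℂ (fun s => G s / (s - 1) ^ m) s :=
    (hG s).div (by fun_prop) (pow_ne_zero m (sub_ne_zero.2 hs))
  exact h2.congr_of_eventuallyEq h1

theorem IsSelberg.differentiableOn_upper (hF : IsSelberg F) :
    DifferentiableOn ℂ F {s | 0 < s.im} := fun s hs =>
  (hF.differentiableAt fun h => by simp [h] at hs).differentiableWithinAt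

theorem apply_eq_zero_of_mem_upperZeros {ρ : ℂ} (hρ : ρ ∈ upperZeros g F) : F ρ = 0 :=
  hρ.2.elim (fun h => h.1) fun h => h.1.1

/-- A non-trivial zero with `Re ρ < 0` would reflect to a zero with real part above `1`, which the
Euler product forbids. -/
theorem IsSelbergPoly.re_mem_Icc_of_mem_upperZeros (hF : IsSelbergPoly F)
    (hg : g.FunctionalEquation F) {ρ : ℂ} (hρ : ρ ∈ upperZeros g F) :
    ρ.re ∈ Set.Icc (0 : ℝ) 1 := by
  have h0 := apply_eq_zero_of_mem_upperZeros hρ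
  obtain ⟨him, h | h⟩ := hρ
  · constructor
    · by_contra! hre
      have hre' : 1 < (1 - conj ρ).re := by
        rw [Complex.sub_re, Complex.conj_re, Complex.one_re]
        linarith
      exact hg.ne_zero_of_reflect (fun h => by simp [h] at him) (fun h => by simp [h] at him) h.2
        (g.not_isPole_of_re_pos (by linarith)) (hF.polynomial_euler_product.ne_zero hre') h0
    · by_contra! hre
      exact hF.polynomial_euler_product.ne_zero hre h0
  · rw [h.2]
    simp

/-- The poles of `γ` have bounded height, so high enough no zero is trivial. -/
theorem exists_mem_upperZeros_of_le_im (g : FEData) (F : ℂ → ℂ) :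
    ∃ t₀ : ℝ, 1 ≤ t₀ ∧ ∀ s : ℂ, t₀ ≤ s.im → F s = 0 → s ∈ upperZeros g F := by
  obtain ⟨t₀, ht₀, h⟩ := g.exists_not_isPole_of_le_abs_im
  exact ⟨t₀, ht₀, fun s hs h0 =>
    ⟨by linarith, Or.inl ⟨h0, h s (hs.trans (le_abs_self _))⟩⟩⟩

/-- The entire function `G` replaces `F` because the compact rectangle contains the possible pole
`1`. -/
theorem IsSelbergPoly.finite_upperZerosBelow (hF : IsSelbergPoly F)
    (hg : g.FunctionalEquation F) (T : ℝ) : (upperZerosBelow g F T).Finite := by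
  obtain ⟨m, G, ⟨hG, -⟩, hFG⟩ := hF.continuation
  have hG2 : G 2 ≠ 0 := by
    rw [← hFG 2 (by norm_num)]
    exact mul_ne_zero (pow_ne_zero m (by norm_num))
      (hF.polynomial_euler_product.ne_zero (by norm_num))
  have hcod : G ⁻¹' {0}ᶜ ∈ codiscreteWithin (Set.univ : Set ℂ) :=
    AnalyticOnNhd.preimage_zero_mem_codiscreteWithin
      (fun s _ => hG.analyticAt s) hG2 (Set.mem_univ _) isConnected_univ
  have hK : IsCompact (Set.Icc (0 : ℝ) 1 ×ℂ Set.Icc (0 : ℝ) T) :=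
    isCompact_Icc.reProdIm isCompact_Icc
  refine (hK.finite_sdiff_of_mem_codiscreteWithin
    (codiscreteWithin_mono (Set.subset_univ _) hcod)).subset fun ρ hρ => ?_
  have him := hρ.1.1
  refine ⟨⟨hF.re_mem_Icc_of_mem_upperZeros hg hρ.1, him.le, hρ.2.le⟩, fun h => h ?_⟩
  rw [Set.mem_singleton_iff, ← hFG ρ fun h => by simp [h] at him,
    apply_eq_zero_of_mem_upperZeros hρ.1, mul_zero]

theorem IsSelberg.deriv_ne_zero (hF : IsSelberg F) {ρ : ℂ} (him : 0 < ρ.im)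
    (h0 : F ρ = 0) (h : analyticOrderAt F ρ = 1) : deriv F ρ ≠ 0 := by
  have ha : AnalyticAt ℂ F ρ := hF.differentiableOn_upper.analyticAt
    ((isOpen_lt continuous_const Complex.continuous_im).mem_nhds him)
  have h1 := ha.analyticOrderAt_deriv_add_one
  simp only [h0, sub_zero] at h1
  rw [h] at h1
  have h2 : analyticOrderAt (deriv F) ρ = 0 := by
    have h3 : analyticOrderAt (deriv F) ρ ≠ ⊤ := fun ht => by simp [ht] at h1
    lift analyticOrderAt (deriv F) ρ to ℕ using h3 with k
    norm_cast at h1 ⊢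
    omega
  exact ha.deriv.analyticOrderAt_eq_zero.1 h2

/-- Between consecutive integers there is a height at which `F` is bounded below. -/
theorem IsSelbergPoly.exists_isGroupingSequence (hF : IsSelbergPoly F)
    (hg : g.FunctionalEquation F)
    (hsimple : ∀ ρ ∈ upperZeros g F, analyticOrderAt F ρ = 1) :
    ∃ T : ℕ → ℝ, IsGroupingSequence F T := by
  classical
  obtain ⟨m, hm, hFm⟩ := hF.polynomial_euler_product.exists_le_norm
  -- The half-radius disc about `3 + i(n + 1/2)` must cover `[-2, 3] × [n, n+1]`: `r/2 = 6` works,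
  -- so `r = 12`, and the disc of radius `3r = 36` reaches real part `39`.
  obtain ⟨C, N, hC, hFC⟩ := hF.exists_norm_le_in_strip (B := 39) (by norm_num)
  obtain ⟨t₀, ht₀, hzero⟩ := exists_mem_upperZeros_of_le_im g F
  set A : ℝ := N + 1 with hA
  -- `t₀ + 40` keeps the discs high enough; the last summand gives `M ≤ n ^ (N + 1)`.
  obtain ⟨n₀, hn₀⟩ := exists_nat_ge (t₀ + 40 + (C / m * 2 ^ N + 2))
  have hD : 0 ≤ C / m * 2 ^ N := by positivity
  have main : ∀ n : ℕ, n₀ ≤ n → ∃ t : ℝ, t ∈ Set.Icc (n : ℝ) (n + 1) ∧ ∀ σ : ℝ, -2 ≤ σ →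
      F (σ + t * Complex.I) ≠ 0 ∧ ‖F (σ + t * Complex.I)‖⁻¹ ≤
        m⁻¹ * Real.exp ((50 * A + 96 * A ^ 2) * Real.log n ^ 2) := by
    intro n hn
    have hnn : t₀ + 40 + (C / m * 2 ^ N + 2) ≤ n := hn₀.trans (by exact_mod_cast hn)
    have hn43 : (43 : ℝ) ≤ n := by linarith
    set ℓ := Real.log n with hℓ
    have hℓ1 : 1 ≤ ℓ := by
      rw [hℓ, Real.le_log_iff_exp_le (by linarith)]
      linarith [Real.exp_one_lt_d9]
    set M : ℝ := 2 + C / m * (n + 38) ^ N with hM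
    have hM1 : 1 < M := by
      have : 0 ≤ C / m * (n + 38 : ℝ) ^ N := by positivity
      linarith
    have hMle : M ≤ (n : ℝ) ^ (N + 1) := by
      have h1 : (1 : ℝ) ≤ (n : ℝ) ^ N := one_le_pow₀ (by linarith)
      calc M ≤ 2 * (n : ℝ) ^ N + C / m * (2 * n) ^ N := by
            rw [hM]
            gcongr
            · linarith
            · linarith
        _ = (C / m * 2 ^ N + 2) * (n : ℝ) ^ N := by rw [mul_pow]; ring
        _ ≤ n * (n : ℝ) ^ N := by gcongr; linarith
        _ = _ := by rw [pow_succ']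
    set L := Real.log M with hL
    have hL0 : 0 ≤ L := (Real.log_pos hM1).le
    have hLle : L ≤ A * ℓ := by
      have h1 := Real.log_le_log (by linarith) hMle
      rw [Real.log_pow] at h1
      push_cast at h1
      exact h1
    set c : ℂ := (3 : ℝ) + (n + 1 / 2 : ℝ) * Complex.I with hc
    have hcre : c.re = 3 := by simp [hc]
    have hcim : c.im = n + 1 / 2 := by simp [hc]
    have hreim : ∀ {R : ℝ} {z : ℂ}, ‖z - c‖ ≤ R → |z.re - 3| ≤ R ∧ |z.im - (n + 1 / 2)| ≤ R := by
      intro R z hz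
      have h1 := (Complex.abs_re_le_norm (z - c)).trans hz
      have h2 := (Complex.abs_im_le_norm (z - c)).trans hz
      rw [Complex.sub_re, hcre] at h1
      rw [Complex.sub_im, hcim] at h2
      exact ⟨h1, h2⟩
    have hcF : m ≤ ‖F c‖ := hFm c (by rw [hcre]; norm_num)
    have hc0 : F c ≠ 0 := norm_pos_iff.1 (hm.trans_le hcF)
    set S : Finset ℂ := (hF.finite_upperZerosBelow hg (n + 13)).toFinset.filter
      (fun z => z ∈ Metric.ball c 12) with hS
    have hSmem : ∀ ρ ∈ S, ρ ∈ Metric.ball c 12 ∧ ρ ∈ upperZeros g F := fun ρ hρ => by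
      rw [hS, Finset.mem_filter, Set.Finite.mem_toFinset] at hρ
      exact ⟨hρ.2, hρ.1.1⟩
    obtain ⟨hcard, hlow⟩ := card_zeros_le_and_le_norm (f := F) (U := {s | 0 < s.im})
      (isOpen_lt continuous_const Complex.continuous_im) hF.differentiableOn_upper
      (c := c) (r := 12) (M := M) (by norm_num) hM1
      (fun z hz => by
        rw [Metric.mem_closedBall, dist_eq_norm] at hz
        have := (abs_le.1 (hreim hz).2).1
        show 0 < z.im
        linarith) hc0
      (fun z hz => by
        rw [Metric.mem_closedBall, dist_eq_norm] at hz
        obtain ⟨h1, h2⟩ := hreim hz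
        rw [abs_le] at h1 h2
        have him : 0 < z.im := by linarith
        have h3 := hFC z (abs_le.2 ⟨by linarith, by linarith⟩)
          (by rw [abs_of_pos him]; linarith)
        rw [abs_of_pos him] at h3
        calc ‖F z‖ ≤ C * (n + 38) ^ N := by
              have h4 : 1 + z.im ≤ n + 38 := by linarith
              exact h3.trans (mul_le_mul_of_nonneg_left
                (pow_le_pow_left₀ (by linarith) h4 N) hC)
          _ = (C / m * (n + 38) ^ N) * m := by field_simp
          _ ≤ M * ‖F c‖ := by
              gcongr
              linarith) (S := S)
      (fun ρ hρ => by
        obtain ⟨h1, h2⟩ := hSmem ρ hρ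
        have h0 := apply_eq_zero_of_mem_upperZeros h2
        exact ⟨h1, h0, hF.deriv_ne_zero h2.1 h0 (hsimple ρ h2)⟩)
      (fun z hz h0 => by
        have h1 := hz
        rw [Metric.mem_ball, dist_eq_norm] at h1
        have h2 := abs_le.1 (hreim h1.le).2
        rw [hS, Finset.mem_filter, Set.Finite.mem_toFinset]
        exact ⟨⟨hzero z (by linarith) h0, by linarith⟩, hz⟩)
    set k : ℝ := (S.card : ℝ) with hk
    have hk0 : 0 ≤ k := Nat.cast_nonneg _
    have hkL : k ≤ 2 * L := by
      have h1 := Real.log_le_log (by positivity) hcard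
      rw [Real.log_pow] at h1
      have h2 : 1 / 2 ≤ Real.log 2 := by linarith [Real.log_two_gt_d9]
      have h3 : k * (1 / 2) ≤ k * Real.log 2 := by gcongr
      linarith
    obtain ⟨t, ht, htS⟩ := exists_mem_Icc_le_abs_sub (S.image Complex.im) n
    refine ⟨t, ht, fun σ hσ => ?_⟩
    suffices h : m * Real.exp (-((50 * A + 96 * A ^ 2) * ℓ ^ 2)) ≤ ‖F (σ + t * Complex.I)‖ by
      have hpos : 0 < m * Real.exp (-((50 * A + 96 * A ^ 2) * ℓ ^ 2)) := by positivity
      refine ⟨norm_pos_iff.1 (hpos.trans_le h), ?_⟩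
      have h1 := inv_anti₀ hpos h
      rwa [mul_inv, ← Real.exp_neg, neg_neg] at h1
    rcases le_total 3 σ with h3 | h3
    · calc _ ≤ m * 1 := by
            gcongr
            rw [Real.exp_le_one_iff]
            linarith [show 0 ≤ (50 * A + 96 * A ^ 2) * ℓ ^ 2 by positivity]
        _ ≤ _ := by
            rw [mul_one]
            exact hFm _ (by simp; linarith)
    · set s : ℂ := σ + t * Complex.I with hs
      have hsc : ‖s - c‖ ≤ 12 / 2 := by
        refine (Complex.norm_le_abs_re_add_abs_im _).trans ?_
        have h1 : |(s - c).re| ≤ 5 := by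
          rw [Complex.sub_re, hcre, abs_le]
          constructor <;> simp [hs] <;> linarith
        have h2 : |(s - c).im| ≤ 1 := by
          rw [Complex.sub_im, hcim, abs_le]
          constructor <;> simp [hs] <;> linarith [ht.1, ht.2]
        linarith
      have h1 := hlow s hsc
      have hfac : ∀ ρ ∈ S, Real.exp (-(24 * (k + 1))) ≤ ‖s - ρ‖ / 12 := by
        intro ρ hρ
        have h2 := htS ρ.im (Finset.mem_image_of_mem _ hρ)
        have h4 : ((S.image Complex.im).card : ℝ) ≤ k := by
          exact Nat.cast_le.2 Finset.card_image_le
        have h5 : |t - ρ.im| ≤ ‖s - ρ‖ := by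
          simpa [hs] using Complex.abs_im_le_norm (s - ρ)
        have h6 : 1 / (2 * (k + 1)) ≤ 1 / (2 * (((S.image Complex.im).card : ℝ) + 1)) := by
          gcongr
        -- Crude, but sufficient: `k = O(log n)` such factors multiply to `exp(-O(log² n))`.
        calc Real.exp (-(24 * (k + 1))) ≤ (24 * (k + 1))⁻¹ := by
              rw [Real.exp_neg]
              refine inv_anti₀ (by positivity) ?_
              linarith [Real.add_one_le_exp (24 * (k + 1))]
          _ = 1 / (2 * (k + 1)) / 12 := by field_simp; norm_num
          _ ≤ _ := by
              gcongr
              linarith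
      have hprod : Real.exp (-(24 * (k + 1)) * k) ≤ ∏ ρ ∈ S, (‖s - ρ‖ / 12) := by
        have h2 := Finset.prod_le_prod (s := S) (fun _ _ => (Real.exp_pos _).le) hfac
        rw [Finset.prod_const, ← Real.exp_nat_mul, mul_comm] at h2
        exact h2
      refine le_trans ?_ h1
      calc _ ≤ m * Real.exp (-(2 * L) + -(24 * (k + 1)) * k) := by
            gcongr
            -- `k ≤ 2L` and `L ≤ Aℓ` produce the constants `96 A²` and `50 A`; `ℓ ≥ 1` absorbs the
            -- linear term.
            have h2 : 24 * (k + 1) * k ≤ 24 * (2 * L + 1) * (2 * L) := by gcongr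
            have h4 : 24 * (2 * L + 1) * (2 * L) + 2 * L = 96 * L ^ 2 + 50 * L := by ring
            have h5 : 96 * L ^ 2 + 50 * L ≤ 96 * (A * ℓ) ^ 2 + 50 * (A * ℓ) := by gcongr
            have h6 : 50 * (A * ℓ) * 1 ≤ 50 * (A * ℓ) * ℓ := by gcongr
            linarith
        _ ≤ _ := by
            rw [Real.exp_add, ← mul_assoc]
            gcongr
  choose! T hT using main
  exact ⟨T, 50 * A + 96 * A ^ 2, m⁻¹, n₀, hT⟩

end SelbergClass

/-! ### Convergence of the grouped sums. -/

/-- `log² n = o(n)`, so half of the exponential decay absorbs the first factor. -/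
theorem summable_exp_log_sq_mul_exp_neg (B : ℝ) {y : ℝ} (hy : 0 < y) :
    Summable fun n : ℕ => Real.exp (B * Real.log (n + 3) ^ 2) * Real.exp (-(n * y)) := by
  have hev : ∀ᶠ n : ℕ in atTop, B * Real.log (n + 3) ^ 2 ≤ y / 2 * (n + 3) := by
    have h1 : (fun x : ℝ => B * Real.log x ^ 2) =o[atTop] fun x => x :=
      (Real.isLittleO_pow_log_id_atTop (n := 2)).const_mul_left B
    have h2 : Tendsto (fun n : ℕ => (n : ℝ) + 3) atTop atTop :=
      tendsto_atTop_add_const_right _ 3 tendsto_natCast_atTop_atTop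
    filter_upwards [h2.eventually (h1.bound (half_pos hy))] with n hn
    rw [Real.norm_of_nonneg (by positivity : (0 : ℝ) ≤ n + 3)] at hn
    exact (Real.le_norm_self _).trans hn
  have hs : Summable fun n : ℕ => Real.exp (n * -(y / 2)) :=
    Real.summable_exp_nat_mul_iff.2 (by linarith)
  refine summable_of_isBigO_nat hs (IsBigO.of_bound (Real.exp (3 * y / 2)) ?_)
  filter_upwards [hev] with n hn
  rw [Real.norm_of_nonneg (by positivity), Real.norm_of_nonneg (by positivity), ← Real.exp_add,
    ← Real.exp_add]
  refine Real.exp_le_exp.2 ?_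
  linarith

theorem one_add_pow_le_exp_log_sq {t x : ℝ} (N : ℕ) (ht : 0 ≤ t) (hx : 3 ≤ x) (h : 1 + t ≤ x) :
    (1 + t) ^ N ≤ Real.exp (N * Real.log x ^ 2) := by
  have h1 : 1 ≤ Real.log x := by
    rw [Real.le_log_iff_exp_le (by linarith)]
    linarith [Real.exp_one_lt_d9]
  calc (1 + t) ^ N ≤ x ^ N := by gcongr
    _ = Real.exp (N * Real.log x) := by rw [Real.exp_nat_mul, Real.exp_log (by linarith)]
    _ ≤ _ := by
      gcongr
      exact le_self_pow₀ h1 two_ne_zero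

namespace SelbergClass

variable {F : ℂ → ℂ} {g : FEData}

/-- On the lines `Re s = -1` and `Re s = 3`, and on the horizontal lines of a grouping sequence,
`1 / F` is at most `exp (O (log n) ^ 2)`. -/
theorem IsSelbergPoly.exists_norm_inv_le (hF : IsSelbergPoly F) (hg : g.FunctionalEquation F)
    {T : ℕ → ℝ} (hT : IsGroupingSequence F T) :
    ∃ (A B : ℝ) (n₀ : ℕ), 0 ≤ A ∧ 0 ≤ B ∧ ∀ n : ℕ, n₀ ≤ n →
      ∀ s ∈ rectangleBoundary (-1) 3 (T n) (T (n + 1)),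
        ‖F s‖⁻¹ ≤ A * Real.exp (B * Real.log (n + 3) ^ 2) := by
  obtain ⟨C, K, n₁, hT⟩ := hT
  obtain ⟨m, hm, hFm⟩ := hF.polynomial_euler_product.exists_le_norm
  -- Bounding `F` on `Re s = 2` by `F` on `Re s = -1` is, read backwards, a lower bound on the left
  -- edge.
  obtain ⟨C₁, N, t₀, hC₁, ht₀, hrefl⟩ := hg.exists_norm_le 2
  obtain ⟨n₂, hn₂⟩ := exists_nat_ge t₀
  refine ⟨|K| + m⁻¹ + C₁ / m, |C| + N, max n₁ (max n₂ 1), by positivity, by positivity,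
    fun n hn s hs => ?_⟩
  simp only [max_le_iff] at hn
  have hn0 : t₀ ≤ n := hn₂.trans (by exact_mod_cast hn.2.1)
  have hn1 : (1 : ℝ) ≤ n := by exact_mod_cast hn.2.2
  have hTn := hT n hn.1
  have hTn1 := hT (n + 1) (by omega)
  have h1n := hTn.1
  have h1n1 := hTn1.1
  push_cast at h1n1
  have hlog0 : 0 ≤ Real.log n := Real.log_nonneg hn1
  have hlog1 : Real.log n ≤ Real.log (n + 3) := Real.log_le_log (by linarith) (by linarith)
  have hlog2 : Real.log (n + 1 : ℕ) ≤ Real.log (n + 3) := by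
    push_cast
    exact Real.log_le_log (by linarith) (by linarith)
  have hlog3 : 0 ≤ Real.log (n + 1 : ℕ) := Real.log_natCast_nonneg _
  set E : ℝ := Real.exp ((|C| + N) * Real.log (n + 3) ^ 2) with hE
  have hE1 : 1 ≤ E := Real.one_le_exp (by positivity)
  have hm0 : 0 ≤ m⁻¹ := by positivity
  have hCm : 0 ≤ C₁ / m := by positivity
  have hhor : ∀ {x : ℝ}, 0 ≤ x → x ≤ Real.log (n + 3) → K * Real.exp (C * x ^ 2) ≤
      (|K| + m⁻¹ + C₁ / m) * E := by
    intro x hx0 hx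
    have h1 : C * x ^ 2 ≤ (|C| + N) * Real.log (n + 3) ^ 2 := by
      have : C ≤ |C| + N := (le_abs_self C).trans (le_add_of_nonneg_right (Nat.cast_nonneg N))
      gcongr
    calc K * Real.exp (C * x ^ 2) ≤ |K| * E := by
          gcongr
          · exact le_abs_self K
          · exact Real.exp_le_exp.2 h1
      _ ≤ _ := by
          gcongr
          linarith
  obtain ⟨⟨hre, him⟩, hbd⟩ := hs
  change s.re ∈ Set.Icc (-1 : ℝ) 3 at hre
  change s.im ∈ Set.Icc (T n) (T (n + 1)) at him
  have hsre := Complex.re_add_im s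
  rcases eq_or_lt_of_le him.1 with h | h
  · rw [← h] at hsre
    have h2 := (hTn.2 s.re (by linarith [hre.1])).2
    rw [hsre] at h2
    exact h2.trans (hhor hlog0 hlog1)
  rcases eq_or_lt_of_le him.2 with h' | h'
  · rw [h'] at hsre
    have h2 := (hTn1.2 s.re (by linarith [hre.1])).2
    rw [hsre] at h2
    exact h2.trans (hhor hlog3 hlog2)
  rcases eq_or_lt_of_le hre.2 with h3 | h3
  · have h2 := inv_anti₀ hm (hFm s (by linarith))
    calc ‖F s‖⁻¹ ≤ m⁻¹ * 1 := by rwa [mul_one]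
      _ ≤ _ := by
        gcongr
        linarith [abs_nonneg K]
  rcases eq_or_lt_of_le hre.1 with h4 | h4
  · have him0 : 0 ≤ s.im := by linarith [h1n.1]
    have h5 := hrefl s.im (by rw [abs_of_nonneg him0]; linarith [h1n.1])
    have e : (((1 - 2 : ℝ) : ℝ) : ℂ) + s.im * Complex.I = s := by
      rw [show (1 - 2 : ℝ) = -1 by norm_num, h4]
      exact hsre
    rw [e, abs_of_nonneg him0] at h5
    have h6 := (hFm ((2 : ℝ) + s.im * Complex.I) (by simp)).trans h5
    have hpos : 0 < ‖F s‖ := by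
      by_contra! hcon
      rw [le_antisymm hcon (norm_nonneg _), mul_zero] at h6
      linarith
    have h7 : (1 + s.im) ^ N ≤ E := by
      refine (one_add_pow_le_exp_log_sq N him0 (x := n + 3) (by linarith)
        (by linarith [h1n1.2])).trans (Real.exp_le_exp.2 ?_)
      gcongr
      exact le_add_of_nonneg_left (abs_nonneg C)
    calc ‖F s‖⁻¹ ≤ C₁ / m * E := by
          rw [inv_le_iff_one_le_mul₀ hpos]
          have h8 : m ≤ C₁ * E * ‖F s‖ := h6.trans (by gcongr)
          calc (1 : ℝ) = m / m := (div_self hm.ne').symm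
            _ ≤ C₁ * E * ‖F s‖ / m := by gcongr
            _ = _ := by ring
      _ ≤ _ := by
        gcongr
        linarith [abs_nonneg K]
  · exact absurd ⟨⟨h4, h3⟩, ⟨h, h'⟩⟩ hbd

/-- The pole of `ζ(s - 1)` at `s = 2` lies below the rectangle, and by `hzero` every zero of `F`
inside it belongs to the sum; the residues are exactly the summands. -/
theorem IsSelbergPoly.groupedSum_sub_groupedSum (hF : IsSelbergPoly F)
    (hg : g.FunctionalEquation F)
    (hsimple : ∀ ρ ∈ upperZeros g F, analyticOrderAt F ρ = 1) (z : ℂ) {T₁ T₂ : ℝ}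
    (hT : T₁ ≤ T₂) (hT₁ : 0 < T₁) (hzero : ∀ s : ℂ, T₁ ≤ s.im → F s = 0 → s ∈ upperZeros g F)
    (h₁ : ∀ σ : ℝ, -2 ≤ σ → F (σ + T₁ * Complex.I) ≠ 0)
    (h₂ : ∀ σ : ℝ, -2 ≤ σ → F (σ + T₂ * Complex.I) ≠ 0) :
    2 * Real.pi * Complex.I * (groupedSum g F z T₂ - groupedSum g F z T₁) =
      rectangleIntegral (fun s => Complex.exp (s * z) * riemannZeta (s - 1) / F s)
        (-1) 3 T₁ T₂ := by
  classical
  set k : ℂ → ℂ := fun s => Complex.exp (s * z) * riemannZeta (s - 1) with hk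
  set res : ℂ → ℂ := fun ρ => k ρ / deriv F ρ with hres
  have hfin := hF.finite_upperZerosBelow hg
  have hsum : ∀ T : ℝ, groupedSum g F z T = ∑ ρ ∈ (hfin T).toFinset, res ρ := fun T =>
    finsum_mem_eq_finite_toFinset_sum _ (hfin T)
  have hsub : (hfin T₁).toFinset ⊆ (hfin T₂).toFinset := fun ρ hρ => by
    rw [Set.Finite.mem_toFinset] at hρ ⊢
    exact ⟨hρ.1, hρ.2.trans_le hT⟩
  rw [hsum, hsum, ← Finset.sum_sdiff hsub, add_sub_cancel_right]
  have hmem : ∀ ρ ∈ (hfin T₂).toFinset \ (hfin T₁).toFinset,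
      ρ ∈ upperZeros g F ∧ T₁ ≤ ρ.im ∧ ρ.im < T₂ := fun ρ hρ => by
    rw [Finset.mem_sdiff, Set.Finite.mem_toFinset, Set.Finite.mem_toFinset] at hρ
    exact ⟨hρ.1.1, not_lt.1 fun h => hρ.2 ⟨hρ.1.1, h⟩, hρ.1.2⟩
  have hopen : IsOpen {s : ℂ | 0 < s.im} := isOpen_lt continuous_const Complex.continuous_im
  have hkd : DifferentiableOn ℂ k {s | 0 < s.im} := fun s hs => by
    have h1 : s - 1 ≠ 1 := fun h => by
      have := congrArg Complex.im h
      simp only [Complex.sub_im, Complex.one_im, sub_zero] at this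
      exact (ne_of_gt hs) this
    have h2 : DifferentiableAt ℂ (fun s => riemannZeta (s - 1)) s :=
      (differentiableAt_riemannZeta h1).comp s (by fun_prop)
    exact (DifferentiableAt.mul (by fun_prop) h2).differentiableWithinAt
  symm
  refine rectangleIntegral_eq_sum_residues (by norm_num) hT res _ (fun ρ hρ => ?_)
    (fun s hs hsS => ?_) (fun ρ hρ => ?_)
  · obtain ⟨h1, h2, h3⟩ := hmem ρ hρ
    have hre := hF.re_mem_Icc_of_mem_upperZeros hg h1
    refine ⟨⟨by linarith [hre.1], by linarith [hre.2]⟩, ⟨lt_of_le_of_ne h2 fun h => ?_, h3⟩⟩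
    refine h₁ ρ.re (by linarith [hre.1]) ?_
    rw [h, Complex.re_add_im]
    exact apply_eq_zero_of_mem_upperZeros h1
  · have him : s.im ∈ Set.Icc T₁ T₂ := hs.2
    have h0 : 0 < s.im := hT₁.trans_le him.1
    refine (hkd.differentiableAt (hopen.mem_nhds h0)).div
      (hF.differentiableOn_upper.differentiableAt (hopen.mem_nhds h0)) fun hFs => hsS ?_
    have hre : s.re ∈ Set.Icc (-1 : ℝ) 3 := hs.1
    have hup := hzero s him.1 hFs
    have hlt : s.im < T₂ := lt_of_le_of_ne him.2 fun h => by
      refine h₂ s.re (by linarith [hre.1]) ?_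
      rwa [← h, Complex.re_add_im]
    rw [Finset.mem_sdiff, Set.Finite.mem_toFinset, Set.Finite.mem_toFinset]
    exact ⟨⟨hup, hlt⟩, fun h => absurd h.2 (not_lt.2 him.1)⟩
  · obtain ⟨h1, h2, h3⟩ := hmem ρ hρ
    have h0 := apply_eq_zero_of_mem_upperZeros h1
    exact exists_eventually_div_eq_add_residue hopen hkd hF.differentiableOn_upper h1.1 h0
      (hF.deriv_ne_zero h1.1 h0 (hsimple ρ h1))

theorem IsSelbergPoly.exists_tendsto_groupedSum (hF : IsSelbergPoly F)
    (hg : g.FunctionalEquation F)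
    (hsimple : ∀ ρ ∈ upperZeros g F, analyticOrderAt F ρ = 1) {T : ℕ → ℝ}
    (hT : IsGroupingSequence F T) {z : ℂ} (hz : 0 < z.im) :
    ∃ L : ℂ, Tendsto (fun n : ℕ => groupedSum g F z (T n)) atTop (𝓝 L) := by
  obtain ⟨A, B, n₁, hA, hB, hinv⟩ := hF.exists_norm_inv_le hg hT
  obtain ⟨_, _, n₂, hT⟩ := hT
  obtain ⟨D, N, hD, hζ⟩ := exists_norm_riemannZeta_le
  obtain ⟨t₀, ht₀, hzero⟩ := exists_mem_upperZeros_of_le_im g F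
  obtain ⟨n₃, hn₃⟩ := exists_nat_ge t₀
  set n₀ := max n₁ (max n₂ n₃) with hn₀
  -- `12` bounds the perimeter: the width is `4` and `T (n + 1) - T n ≤ 2`.
  set K : ℝ := Real.exp (3 * |z.re|) * D * A * 12 with hK
  set u : ℕ → ℝ := fun n => K * (Real.exp ((N + B) * Real.log (n + 3) ^ 2)
    * Real.exp (-(n * z.im))) with hu
  have husum : Summable u := (summable_exp_log_sq_mul_exp_neg (N + B) hz).mul_left K
  have hstep : ∀ n : ℕ, n₀ ≤ n →
      dist (groupedSum g F z (T n)) (groupedSum g F z (T (n + 1))) ≤ u n := by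
    intro n hn
    simp only [hn₀, max_le_iff] at hn
    have hn0 : t₀ ≤ n := hn₃.trans (by exact_mod_cast hn.2.2)
    obtain ⟨⟨h1, h2⟩, hne⟩ := hT n hn.2.1
    obtain ⟨⟨h3, h4⟩, hne'⟩ := hT (n + 1) (by omega)
    push_cast at h3 h4
    have hTT : T n ≤ T (n + 1) := by linarith
    have hres := hF.groupedSum_sub_groupedSum hg hsimple z hTT (by linarith)
      (fun s hs => hzero s (by linarith)) (fun σ hσ => (hne σ hσ).1) fun σ hσ => (hne' σ hσ).1
    have hbound : ∀ s ∈ rectangleBoundary (-1) 3 (T n) (T (n + 1)),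
        ‖Complex.exp (s * z) * riemannZeta (s - 1) / F s‖ ≤
          Real.exp (3 * |z.re|) * D * A * (Real.exp ((N + B) * Real.log (n + 3) ^ 2)
            * Real.exp (-(n * z.im))) := by
      intro s hs
      have h5 := hinv n hn.1 s hs
      have hre : s.re ∈ Set.Icc (-1 : ℝ) 3 := hs.1.1
      have him : s.im ∈ Set.Icc (T n) (T (n + 1)) := hs.1.2
      have him0 : 0 ≤ s.im := by linarith [him.1]
      have hexp : ‖Complex.exp (s * z)‖ ≤ Real.exp (3 * |z.re|) * Real.exp (-(n * z.im)) := by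
        rw [Complex.norm_exp, ← Real.exp_add, Complex.mul_re]
        refine Real.exp_le_exp.2 ?_
        have h6 : s.re * z.re ≤ 3 * |z.re| := by
          refine (le_abs_self _).trans ?_
          rw [abs_mul]
          gcongr
          exact abs_le.2 ⟨by linarith [hre.1], hre.2⟩
        have h7 : n * z.im ≤ s.im * z.im := by
          gcongr
          linarith [him.1]
        linarith
      have hzeta : ‖riemannZeta (s - 1)‖ ≤ D * Real.exp (N * Real.log (n + 3) ^ 2) := by
        have h6 := hζ (s - 1)
          (by rw [Complex.sub_re, Complex.one_re, abs_le]
              constructor <;> linarith [hre.1, hre.2])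
          (by rw [Complex.sub_im, Complex.one_im, sub_zero, abs_of_nonneg him0]
              linarith [him.1])
        rw [Complex.sub_im, Complex.one_im, sub_zero, abs_of_nonneg him0] at h6
        refine h6.trans (mul_le_mul_of_nonneg_left ?_ hD)
        exact one_add_pow_le_exp_log_sq N him0 (by linarith [him.1]) (by linarith [him.2])
      rw [norm_div, norm_mul, div_eq_mul_inv]
      calc _ ≤ Real.exp (3 * |z.re|) * Real.exp (-(n * z.im)) *
            (D * Real.exp (N * Real.log (n + 3) ^ 2)) *
            (A * Real.exp (B * Real.log (n + 3) ^ 2)) := by gcongr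
        _ = _ := by
          rw [add_mul, Real.exp_add]
          ring
    have hnorm := norm_rectangleIntegral_le (by norm_num) hTT hbound
    rw [← hres, norm_mul] at hnorm
    have h2pi : 1 ≤ ‖(2 * Real.pi * Complex.I : ℂ)‖ := by
      rw [norm_mul, norm_mul, Complex.norm_I, Complex.norm_real, Complex.norm_ofNat,
        Real.norm_of_nonneg Real.pi_pos.le]
      linarith [Real.pi_gt_three]
    rw [dist_comm, dist_eq_norm]
    refine (le_mul_of_one_le_left (norm_nonneg _) h2pi).trans (hnorm.trans ?_)
    have h12 : 2 * ((3 : ℝ) - -1) + 2 * (T (n + 1) - T n) ≤ 12 := by linarith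
    calc _ ≤ Real.exp (3 * |z.re|) * D * A * (Real.exp ((N + B) * Real.log (n + 3) ^ 2)
            * Real.exp (-(n * z.im))) * 12 := by gcongr
      _ = u n := by
        simp only [hu, hK]
        ring
  have hcauchy : CauchySeq fun n : ℕ => groupedSum g F z (T (n + n₀)) := by
    refine cauchySeq_of_dist_le_of_summable (fun n => u (n + n₀)) (fun n => ?_)
      ((summable_nat_add_iff n₀).2 husum)
    have := hstep (n + n₀) (Nat.le_add_left _ _)
    rwa [show n + n₀ + 1 = n + 1 + n₀ by ring] at this
  obtain ⟨L, hL⟩ := cauchySeq_tendsto_of_complete hcauchy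
  exact ⟨L, (tendsto_add_atTop_iff_nat n₀).1 hL⟩

end SelbergClass

theorem fact2p1 (F : ℂ → ℂ) (hF : SelbergClass.IsSelbergPoly F)
    (g : SelbergClass.FEData) (hg : g.FunctionalEquation F)
    (hsimple : ∀ ρ ∈ SelbergClass.upperZeros g F, analyticOrderAt F ρ = 1) :
    (∀ T : ℝ, (SelbergClass.upperZerosBelow g F T).Finite) ∧
    (∃ T : ℕ → ℝ, SelbergClass.IsGroupingSequence F T) ∧
    ∀ T : ℕ → ℝ, SelbergClass.IsGroupingSequence F T →
      ∀ z : ℂ, 0 < z.im →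
        ∃ L : ℂ, Tendsto (fun n : ℕ => SelbergClass.groupedSum g F z (T n)) atTop (𝓝 L) :=
  ⟨hF.finite_upperZerosBelow hg, hF.exists_isGroupingSequence hg hsimple,
    fun _ hT _ hz => hF.exists_tendsto_groupedSum hg hsimple hT hz⟩
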